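/- **Setting.** There are $n\ge 1$ boxes; opening box $i$ costs $c_i>0$. A scenario is a vector of volumes $v\in[0,\infty)^n$, drawn from an arbitrary (possibly correlated) probability distribution $\mathcal D$. A partially adaptive algorithm fixes an order of the boxes, opens them one by one in this order, and after each opening decides, from the volumes revealed so far, whether to stop (it must open at least one box, and stops at the latest when all boxes are open); it pays the costs of the opened boxes plus the minimum volume of an opened box. $\mathrm{OPT}$ is the infimum of the expected payment over all partially adaptive algorithms. **Programs.** A feasible solution of the General-Cost convex program is a family of non-decreasing functions $X_i$ with values in $[0,1]$ and $X_i(t)=0$ for $t<0$, such that $\sum_i (X_i(t)-X_i(t-c_i))\le 1$ for all $t\ge 0$. Its objective is $\mathbf E_{v\sim\mathcal D}\,\mathrm{CP}(X\mid v)$, where $$\mathrm{CP}(X\mid v)=\int_0^\infty\Big(1-\sum_i X_i(t-v_i-c_i)\Big)_+dt .$$ Let $\mathrm{CP}$ be the infimum of the objective over feasible solutions. For a scenario $v$, an LP-assignment for $X$ is a family of non-decreasing functions $Z_i$ with values in $[0,1]$ and $Z_i(t)=0$ for $t<0$, such that $Z_i(t')-Z_i(t)\le X_i(t')-X_i(t)$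 for $t\le t'$ and $\sum_i Z_i(\infty)=1$; its LP objective is $\sum_i\int_{[0,\infty)}(t+c_i+v_i)\,dZ_i(t)$. **Algorithm.** Given a feasible $X$, let $\bar x_i(t)=\frac1t\int_0^t (X_i(s)-X_i(s-c_i))\,ds$. In (continuous-time) Poisson Rounding the boxes $i$ arrive according to independent non-homogeneous Poisson processes, independent of the scenario, with rate $\frac1{c_i}\bar x_i(\frac{\tau}{2})$ at time $\tau$; $\alpha_i\in[0,\infty]$ is the first arrival time of box $i$. Balanced Stopping puts $\tau_i=\max\{\alpha_i,c_i+v_i\}$ and $\tau^*=\min_i\tau_i$, opens every box with $\alpha_i\le\tau^*$ (in the order of the $\alpha_i$), and takes at time $\tau^*$ a box $i^*$ with $\tau_{i^*}=\tau^*$, ties being broken arbitrarily. Its objective is $\sum_{j:\alpha_j\le\tau^*}c_j+v_{i^*}$ (and $\infty$ if $\tau^*=\infty$). **Theorem.** Let $X$ be a feasible solution of the General-Cost convex program, and run Balanced Stopping with Poisson Rounding on $X$. 1. If $\varepsilon\ge 0$ and the objective of $X$ is at most $(1+\varepsilon)\,\mathrm{CP}$, then the expected objective of the algorithm is at most $4(1+\varepsilon)\,\mathrm{OPT}$.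 In particular, on an optimal solution the algorithm is a $4$-approximation to the optimal partially adaptive algorithm. 2. In every fixed scenario $v$, the expected objective of the algorithm is at most $4\,\mathrm{CP}(X\mid v)$. 3. In every fixed scenario $v$, the expected objective of the algorithm is at most $4$ times the LP objective of any LP-assignment $Z$ for $X$. 4. For every realization of $\alpha_1,\dots,\alpha_n$ there is a partially adaptive algorithm that opens the boxes in ascending order of the $\alpha_i$ and whose payment is, in every scenario, at most the objective of Balanced Stopping for that realization. -/

import Mathlib

open MeasureTheory ProbabilityTheory Set Filter Topology
open scoped NNReal ENNReal

namespace Pandora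

noncomputable section

/-! ### Partially adaptive algorithms

An instance has `n` boxes with opening costs `c : Fin n → ℝ≥0`; a scenario is the vector of volumes
`v : Fin n → ℝ≥0`, drawn from a probability measure `D`. -/

/-- A (deterministic) partially adaptive algorithm. It fixes an order of the boxes: `order j` is the
`j`-th box to be opened, counted from `0`. After the first `k` boxes have been opened, it stops if
and only if `v ∈ stopSet k`, and this decision depends only on the volumes revealed so far. -/
structure PartiallyAdaptive (n : ℕ) where
  order : Equiv.Perm (Fin n)
  stopSet : ℕ → Set (Fin n → ℝ≥0)
  measurableSet_stopSet : ∀ k, MeasurableSet (stopSet k)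
  adapted : ∀ (k : ℕ) (v w : Fin n → ℝ≥0),
    (∀ j : Fin n, (j : ℕ) < k → v (order j) = w (order j)) → (v ∈ stopSet k ↔ w ∈ stopSet k)

/-- The number of boxes opened in scenario `v`: at least one box has to be opened (since an opened
box has to be taken), and the algorithm has to stop once all boxes are open. -/
def PartiallyAdaptive.numOpened {n : ℕ} (A : PartiallyAdaptive n) (v : Fin n → ℝ≥0) : ℕ :=
  sInf {k : ℕ | 1 ≤ k ∧ (n ≤ k ∨ v ∈ A.stopSet k)}

/-- The objective in scenario `v`: the opening costs of the opened boxes plus the minimum volume of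
an opened box. -/
def PartiallyAdaptive.cost {n : ℕ} (A : PartiallyAdaptive n) (c v : Fin n → ℝ≥0) : ℝ≥0∞ :=
  (∑ j : Fin n, if (j : ℕ) < A.numOpened v then (c (A.order j) : ℝ≥0∞) else 0) +
    ⨅ j : Fin n, ⨅ _ : (j : ℕ) < A.numOpened v, (v (A.order j) : ℝ≥0∞)

/-- The optimal expected objective of a partially adaptive algorithm. -/
def opt {n : ℕ} (c : Fin n → ℝ≥0) (D : Measure (Fin n → ℝ≥0)) : ℝ≥0∞ :=
  ⨅ A : PartiallyAdaptive n, ∫⁻ v, A.cost c v ∂D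

/-! ### The General-Cost convex and linear programs -/

/-- Feasibility for the convex program. `X i t` stands for the probability that the start time of
box `i` is at most `t`; in particular it vanishes for `t < 0`. -/
structure IsCPFeasible {n : ℕ} (c : Fin n → ℝ≥0) (X : Fin n → ℝ → ℝ) : Prop where
  eq_zero_of_neg : ∀ i t, t < 0 → X i t = 0
  monotone : ∀ i, Monotone (X i)
  nonneg : ∀ i t, 0 ≤ X i t
  le_one : ∀ i t, X i t ≤ 1
  opening_le_one : ∀ t : ℝ, 0 ≤ t → ∑ i, (X i t - X i (t - c i)) ≤ 1

/-- The objective of the convex program in the fixed scenario `v`. -/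
def cpCost {n : ℕ} (c v : Fin n → ℝ≥0) (X : Fin n → ℝ → ℝ) : ℝ≥0∞ :=
  ∫⁻ t in Ioi (0 : ℝ), ENNReal.ofReal (max (1 - ∑ i, X i (t - v i - c i)) 0)

/-- The objective of the convex program. -/
def cpObjective {n : ℕ} (c : Fin n → ℝ≥0) (D : Measure (Fin n → ℝ≥0)) (X : Fin n → ℝ → ℝ) :
    ℝ≥0∞ :=
  ∫⁻ v, cpCost c v X ∂D

/-- The optimal value of the convex program. -/
def cpOpt {n : ℕ} (c : Fin n → ℝ≥0) (D : Measure (Fin n → ℝ≥0)) : ℝ≥0∞ :=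
  ⨅ X : Fin n → ℝ → ℝ, ⨅ _ : IsCPFeasible c X, cpObjective c D X

/-- The constraints of the linear program on the variables `Z i t = Z i (t | v)` of one scenario `v`,
given `X`: `Z i t` stands for the probability that box `i` has start time at most `t` and is taken
in scenario `v`. -/
structure IsLPAssignment {n : ℕ} (X Z : Fin n → ℝ → ℝ) : Prop where
  eq_zero_of_neg : ∀ i t, t < 0 → Z i t = 0
  monotone : ∀ i, Monotone (Z i)
  nonneg : ∀ i t, 0 ≤ Z i t
  le_one : ∀ i t, Z i t ≤ 1
  sub_le_sub : ∀ i t t', t ≤ t' → Z i t' - Z i t ≤ X i t' - X i t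
  total : Tendsto (fun t => ∑ i, Z i t) atTop (𝓝 1)

/-- The objective `∑ i, ∫ (t + c i + v i) dZ i (t)` of the linear program in the scenario `v`. The
integrals are Lebesgue–Stieltjes integrals (they include a possible atom at time `0`). -/
def lpCost {n : ℕ} (c v : Fin n → ℝ≥0) (Z : Fin n → ℝ → ℝ) (hZ : ∀ i, Monotone (Z i)) : ℝ≥0∞ :=
  ∑ i, ∫⁻ t, ENNReal.ofReal (t + c i + v i) ∂((hZ i).stieltjesFunction.measure)

/-! ### Poisson Rounding -/

/-- The average probability, over the first `t` time units, that box `i` is being opened. -/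
def xbar {n : ℕ} (c : Fin n → ℝ≥0) (X : Fin n → ℝ → ℝ) (i : Fin n) (t : ℝ) : ℝ :=
  1 / t * ∫ s in (0 : ℝ)..t, (X i s - X i (s - c i))

/-- The arrival rate of box `i` at time `τ` of the Poisson time horizon. -/
def arrivalRate {n : ℕ} (c : Fin n → ℝ≥0) (X : Fin n → ℝ → ℝ) (i : Fin n) (τ : ℝ) : ℝ :=
  1 / (c i : ℝ) * xbar c X i (τ / 2)

/-- `N` is (the counting process of) a non-homogeneous Poisson process with rate `r`. -/
structure IsPoissonProcess {Ω : Type*} [MeasurableSpace Ω] (N : ℝ≥0 → Ω → ℕ) (r : ℝ → ℝ)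
    (P : Measure Ω) : Prop where
  measurable : ∀ t, Measurable (N t)
  zero : ∀ᵐ ω ∂P, N 0 ω = 0
  monotone : ∀ᵐ ω ∂P, Monotone fun t => N t ω
  rightContinuous : ∀ᵐ ω ∂P, ∀ t, ContinuousWithinAt (fun s => N s ω) (Ici t) t
  indepIncrements : HasIndepIncrements N P
  law_increment : ∀ s t : ℝ≥0, s ≤ t →
    P.map (fun ω => N t ω - N s ω) = poissonMeasure (∫ τ in (s : ℝ)..t, r τ).toNNReal

/-- The time of the first arrival of a counting path (`⊤` if there is none). -/
def firstArrival (N : ℝ≥0 → ℕ) : ℝ≥0∞ :=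
  ⨅ t : ℝ≥0, ⨅ _ : 1 ≤ N t, (t : ℝ≥0∞)

/-! ### Balanced Stopping -/

/-- The time `τ_i = max {α_i, β_i}`, with balanced time `β_i = c_i + v_i`, from which on box `i` can be
taken, when the first arrivals of the boxes are at the times `α`. -/
def takeTime {n : ℕ} (c v : Fin n → ℝ≥0) (α : Fin n → ℝ≥0∞) (i : Fin n) : ℝ≥0∞ :=
  max (α i) ((c i : ℝ≥0∞) + v i)

/-- The stopping time `τ* = min_i τ_i` (in the Poisson time horizon). -/
def stoppingTime {n : ℕ} (c v : Fin n → ℝ≥0) (α : Fin n → ℝ≥0∞) : ℝ≥0∞ :=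
  ⨅ i, takeTime c v α i

/-- The objective of Balanced Stopping in scenario `v` when the first arrivals are at the times `α`:
the costs of all boxes that arrive by time `τ*`, plus the volume of the taken box `i*`, a minimizer
of `τ_i`. If there are several minimizers, the algorithm is charged the largest of their volumes, so
that ties may be broken in any way. If the algorithm never stops, its objective is `⊤`. -/
def balancedCost {n : ℕ} (c v : Fin n → ℝ≥0) (α : Fin n → ℝ≥0∞) : ℝ≥0∞ :=
  open scoped Classical in
  if stoppingTime c v α = ⊤ then ⊤
  else (∑ j, if α j ≤ stoppingTime c v α then (c j : ℝ≥0∞) else 0) +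
    ⨆ i, ⨆ _ : takeTime c v α i = stoppingTime c v α, (v i : ℝ≥0∞)

/-- The expected objective, in the fixed scenario `v`, of Balanced Stopping with the box arrivals
given by the counting processes `N i`. -/
def balancedExpectedCost {n : ℕ} {Ω : Type*} [MeasurableSpace Ω] (c v : Fin n → ℝ≥0)
    (N : Fin n → ℝ≥0 → Ω → ℕ) (P : Measure Ω) : ℝ≥0∞ :=
  ∫⁻ ω, balancedCost c v (fun i => firstArrival fun t => N i t ω) ∂P

end

end Pandora

/-! Everything reduces to the bound `4 * cpCost` in a fixed scenario `v`. Integrating it over `D`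
and using `cpOpt ≤ opt` gives the approximation ratio; `cpCost ≤ lpCost` gives the comparison with
the linear program.

In a fixed scenario write `λ i` for the arrival rate. Two facts about it are used: `∑ c i * λ i ≤
1`, so the opening cost accrues at rate at most 1, and `λ i t ≥ (2 / t) * X i (t / 2 - c i)`. By the
second, each arrival process splits into independent parts with rates `r i t = (2 / t) * min (X i
((t - v i) / 2 - c i)) (L i)` and `λ i - r i`; the caps `L i` sum to at most 1, so `∑ r i ≤ 2 / t`.
A box of the first part arrives only after its balanced time and can be taken at once.

Let `ρ` be the first arrival of the first part and `σ` the stopping time of the second, so that the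
algorithm stops at `min ρ σ`. The expected opening cost is at most `E min(ρ, σ)`. If `σ ≤ ρ`, the
volume of the taken box is at most the stopping time `σ`; otherwise it is the volume of the box that
attains `ρ`. Since the hazard rate of `ρ` is at most `2 / t`, its survival function `q` makes `t²
q(t)` increasing, hence `s q(s) ≤ ∫_s^∞ q`. So for each value of `σ` the charge `σ` on `{σ ≤ ρ}` is
covered by the remaining waiting time for `ρ`, and the total is at most `E ρ` plus the expected
volume at `ρ`.

That quantity is bounded by comparison with free stops at the delayed rates `2 z i (t - v i) / t`,
where `r i t = 2 z i t / t`: the monotonicity of `t² q(t)` bounds the volume by the delay in first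
order, and `1 + D ≤ exp D` turns first order into the true delayed survival function. A time with
hazard rate `2 G(t) / t` has mean at most `2 ∫ (1 - G)`, and rescaling time by 2 gives the second
factor 2 in the constant 4. -/

namespace Pandora

/-! ### Hazard rates and survival functions -/

/-- A bounded measurable hazard rate which is continuous off a countable set. -/
structure IsRate (r : ℝ → ℝ) : Prop where
  measurable : Measurable r
  nonneg : ∀ t, 0 ≤ r t
  bounded : ∃ C, ∀ t, r t ≤ C
  countable : {t | ¬ContinuousAt r t}.Countable

/-- The survival function of a nonnegative random time with hazard rate `r`. -/
noncomputable def surv (r : ℝ → ℝ) (t : ℝ) : ℝ := Real.exp (-∫ u in (0 : ℝ)..t, r u)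

namespace IsRate

variable {r r' : ℝ → ℝ}

theorem intervalIntegrable (hr : IsRate r) (a b : ℝ) : IntervalIntegrable r volume a b := by
  obtain ⟨C, hC⟩ := hr.bounded
  refine (intervalIntegrable_const (c := C)).mono_fun hr.measurable.aestronglyMeasurable ?_
  filter_upwards with t
  rw [Real.norm_of_nonneg (hr.nonneg t)]
  exact (hC t).trans (le_abs_self C)

theorem continuous_integral (hr : IsRate r) : Continuous fun t => ∫ u in (0 : ℝ)..t, r u :=
  intervalIntegral.continuous_primitive hr.intervalIntegrable 0

theorem continuous_surv (hr : IsRate r) : Continuous (surv r) :=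
  Real.continuous_exp.comp hr.continuous_integral.neg

theorem surv_eq (hr : IsRate r) (s t : ℝ) :
    surv r t = surv r s * Real.exp (-∫ u in s..t, r u) := by
  rw [surv, surv, ← Real.exp_add, ← intervalIntegral.integral_add_adjacent_intervals
    (hr.intervalIntegrable 0 s) (hr.intervalIntegrable s t), neg_add]

theorem antitone_surv (hr : IsRate r) : Antitone (surv r) := by
  intro s t hst
  rw [hr.surv_eq s t]
  refine mul_le_of_le_one_right (Real.exp_pos _).le (Real.exp_le_one_iff.2 ?_)
  exact neg_nonpos.2 (intervalIntegral.integral_nonneg hst fun u _ => hr.nonneg u)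

theorem add (hr : IsRate r) (hr' : IsRate r') : IsRate fun t => r t + r' t where
  measurable := hr.measurable.add hr'.measurable
  nonneg t := add_nonneg (hr.nonneg t) (hr'.nonneg t)
  bounded := by
    obtain ⟨C, hC⟩ := hr.bounded
    obtain ⟨C', hC'⟩ := hr'.bounded
    exact ⟨C + C', fun t => add_le_add (hC t) (hC' t)⟩
  countable := (hr.countable.union hr'.countable).mono fun t ht => by
    by_contra h
    simp only [mem_union, mem_ofPred_eq, not_or, not_not] at h
    exact ht (h.1.add h.2)

theorem sub (hr : IsRate r) (hr' : IsRate r') (h : ∀ t, r' t ≤ r t) :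
    IsRate fun t => r t - r' t where
  measurable := hr.measurable.sub hr'.measurable
  nonneg t := sub_nonneg.2 (h t)
  bounded := by
    obtain ⟨C, hC⟩ := hr.bounded
    exact ⟨C, fun t => (sub_le_self _ (hr'.nonneg t)).trans (hC t)⟩
  countable := (hr.countable.union hr'.countable).mono fun t ht => by
    by_contra h
    simp only [mem_union, mem_ofPred_eq, not_or, not_not] at h
    exact ht (h.1.sub h.2)

theorem hasDerivAt_surv (hr : IsRate r) {t : ℝ} (ht : ContinuousAt r t) :
    HasDerivAt (surv r) (-(r t * surv r t)) t := by
  have h1 : HasDerivAt (fun t => ∫ u in (0 : ℝ)..t, r u) (r t) t :=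
    intervalIntegral.integral_hasDerivAt_right (hr.intervalIntegrable 0 t)
      hr.measurable.stronglyMeasurable.stronglyMeasurableAtFilter ht
  have h2 : HasDerivAt (surv r) _ t := h1.neg.exp
  refine h2.congr_deriv ?_
  change Real.exp (-∫ u in (0 : ℝ)..t, r u) * -r t = -(r t * Real.exp (-∫ u in (0 : ℝ)..t, r u))
  ring

theorem intervalIntegrable_mul_surv (hr : IsRate r) (a b : ℝ) :
    IntervalIntegrable (fun t => r t * surv r t) volume a b :=
  (hr.intervalIntegrable a b).mul_continuousOn hr.continuous_surv.continuousOn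

theorem integral_mul_surv (hr : IsRate r) (a b : ℝ) :
    ∫ t in a..b, r t * surv r t = surv r a - surv r b := by
  have := integral_eq_of_hasDerivAt_off_countable (a := a) (b := b) (fun t => -surv r t)
    (fun t => r t * surv r t) hr.countable hr.continuous_surv.neg.continuousOn
    (fun t ht => by
      have h := (hr.hasDerivAt_surv (not_not.1 ht.2)).neg
      rwa [neg_neg] at h)
    (hr.intervalIntegrable_mul_surv a b)
  rw [this]; ring

end IsRate

theorem surv_pos (r : ℝ → ℝ) (t : ℝ) : 0 < surv r t := Real.exp_pos _

@[simp] theorem surv_zero (r : ℝ → ℝ) : surv r 0 = 1 := by simp [surv]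

theorem IsRate.surv_le_one {r : ℝ → ℝ} (hr : IsRate r) {t : ℝ} (ht : 0 ≤ t) : surv r t ≤ 1 := by
  simpa using hr.antitone_surv ht

theorem isRate_sum {n : ℕ} {r : Fin n → ℝ → ℝ} (hr : ∀ i, IsRate (r i)) :
    IsRate fun t => ∑ i, r i t := by
  classical
  suffices h : ∀ s : Finset (Fin n), IsRate fun t => ∑ i ∈ s, r i t from h _
  intro s
  induction s using Finset.induction_on with
  | empty => exact ⟨by simp, by simp, ⟨0, by simp⟩, by simp [continuousAt_const]⟩
  | insert a s ha ih => simpa only [Finset.sum_insert ha] using (hr a).add ih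

theorem surv_sum {n : ℕ} {r : Fin n → ℝ → ℝ} (hr : ∀ i, IsRate (r i)) (t : ℝ) :
    surv (fun t => ∑ i, r i t) t = ∏ i, surv (r i) t := by
  simp only [surv]
  rw [← Real.exp_sum, intervalIntegral.integral_finsetSum fun i _ => (hr i).intervalIntegrable 0 t,
    Finset.sum_neg_distrib]

/-- Multiplicativity of survival functions under superposition of rates; this is the analytic form
of thinning. -/
theorem surv_sub {r r' : ℝ → ℝ} (hr : IsRate r) (hr' : IsRate r') (t : ℝ) :
    surv r' t * surv (fun t => r t - r' t) t = surv r t := by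
  simp only [surv]
  rw [← Real.exp_add, intervalIntegral.integral_sub (hr.intervalIntegrable 0 t)
    (hr'.intervalIntegrable 0 t)]
  ring_nf

/-- The rate `2 y(t) / t` of a bounded increasing function that vanishes near and below `0`. -/
theorem isRate_two_div_mul {y : ℝ → ℝ} (hy : Monotone y) {δ : ℝ} (hδ : 0 < δ)
    (h0 : ∀ t < δ, y t = 0) {B : ℝ} (hB : ∀ t, y t ≤ B) : IsRate fun t => 2 / t * y t := by
  have hnn : ∀ t, 0 ≤ y t := fun t => by
    rcases lt_or_ge t δ with h | h
    · exact (h0 t h).ge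
    · exact (h0 (δ - 1) (by linarith)).symm.le.trans (hy (by linarith))
  refine ⟨?_, ?_, ⟨2 / δ * B, ?_⟩, ?_⟩
  · exact (measurable_const.div measurable_id).mul hy.measurable
  · intro t
    rcases lt_or_ge t δ with h | h
    · simp [h0 t h]
    · exact mul_nonneg (div_nonneg zero_le_two (by linarith)) (hnn t)
  · intro t
    have hB0 : 0 ≤ B := (hnn 0).trans (hB 0)
    rcases lt_or_ge t δ with h | h
    · rw [h0 t h]; simp only [mul_zero]; positivity
    · have : 0 < t := by linarith
      exact mul_le_mul (div_le_div_of_nonneg_left zero_le_two hδ h) (hB t) (hnn t) (by positivity)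
  · refine (hy.countable_not_continuousAt.union (countable_singleton (0 : ℝ))).mono fun t ht => ?_
    by_contra h
    simp only [mem_union, mem_ofPred_eq, mem_singleton_iff, not_or, not_not] at h
    exact ht ((continuousAt_const.div continuousAt_id h.2).mul h.1)

theorem lintegral_Ioi_le_of_forall_Ioc {F : ℝ → ℝ≥0∞} {K : ℝ≥0∞}
    (h : ∀ S : ℝ, 0 ≤ S → ∫⁻ t in Ioc 0 S, F t ≤ K) : ∫⁻ t in Ioi (0 : ℝ), F t ≤ K := by
  have hU : Ioi (0 : ℝ) = ⋃ k : ℕ, Ioc (0 : ℝ) k := by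
    ext t
    simp only [mem_Ioi, mem_iUnion, mem_Ioc]
    exact ⟨fun ht => ⟨⌈t⌉₊, ht, Nat.le_ceil t⟩, fun ⟨_, ht, _⟩ => ht⟩
  rw [hU, setLIntegral_iUnion_of_directed]
  · exact iSup_le fun k => h k k.cast_nonneg
  · refine Monotone.directed_le (f := fun k : ℕ => Ioc (0 : ℝ) k) fun k l hkl => ?_
    exact Ioc_subset_Ioc_right (by exact_mod_cast hkl)

theorem lintegral_Ioc_ofReal {f : ℝ → ℝ} {a b : ℝ} (hab : a ≤ b)
    (hf : IntervalIntegrable f volume a b) (h0 : ∀ t ∈ Ioc a b, 0 ≤ f t) :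
    ∫⁻ t in Ioc a b, ENNReal.ofReal (f t) = ENNReal.ofReal (∫ t in a..b, f t) := by
  rw [intervalIntegral.integral_of_le hab, ofReal_integral_eq_lintegral_ofReal hf.1]
  exact (ae_restrict_iff' measurableSet_Ioc).2 (ae_of_all _ h0)

/-- A time with hazard rate `2 G(t) / t` has mean at most `2 ∫ (1 - G)`. -/
theorem lintegral_surv_le {G : ℝ → ℝ} (hG : Monotone G) {δ : ℝ} (hδ : 0 < δ)
    (h0 : ∀ t < δ, G t = 0) (h1 : ∀ t, G t ≤ 1) :
    ∫⁻ t in Ioi (0 : ℝ), ENNReal.ofReal (surv (fun u => 2 / u * G u) t) ≤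
      2 * ∫⁻ t in Ioi (0 : ℝ), ENNReal.ofReal (1 - G t) := by
  set r : ℝ → ℝ := fun u => 2 / u * G u with hr_def
  have hr : IsRate r := isRate_two_div_mul hG hδ h0 h1
  have hrt : ∀ t, t * r t = 2 * G t := fun t => by
    rcases eq_or_ne t 0 with rfl | ht
    · simp [h0 0 hδ]
    · simp only [hr_def]; field_simp
  refine lintegral_Ioi_le_of_forall_Ioc fun S hS => ?_
  have hGi : ∀ a b, IntervalIntegrable G volume a b := fun a b => hG.intervalIntegrable
  have hsi : ∀ a b, IntervalIntegrable (surv r) volume a b :=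
    fun a b => hr.continuous_surv.intervalIntegrable a b
  have hGs : IntervalIntegrable (fun t => G t * surv r t) volume 0 S :=
    (hGi 0 S).mul_continuousOn hr.continuous_surv.continuousOn
  -- Since `t * r t = 2 * G t`, the integrand is the derivative of `t * surv r t`. As the boundary
  -- term is nonnegative, `∫ surv ≤ 2 ∫ (1 - G) * surv`.
  have key : ∫ t in (0 : ℝ)..S, (surv r t - 2 * (G t * surv r t)) = S * surv r S := by
    have := integral_eq_of_hasDerivAt_off_countable (a := 0) (b := S) (fun t => t * surv r t)
      (fun t => surv r t - 2 * (G t * surv r t)) hr.countable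
      (continuous_id.mul hr.continuous_surv).continuousOn
      (fun t ht => by
        refine ((hasDerivAt_id t).mul (hr.hasDerivAt_surv (not_not.1 ht.2))).congr_deriv ?_
        change 1 * surv r t + t * -(r t * surv r t) = surv r t - 2 * (G t * surv r t)
        linear_combination -surv r t * hrt t)
      ((hsi 0 S).sub (hGs.const_mul 2))
    simpa using this
  rw [intervalIntegral.integral_sub (hsi 0 S) (hGs.const_mul 2),
    intervalIntegral.integral_const_mul] at key
  have h2 : ∫ t in (0 : ℝ)..S, surv r t ≤ 2 * ∫ t in (0 : ℝ)..S, (1 - G t) := by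
    have h3 : ∫ t in (0 : ℝ)..S, (1 - G t) * surv r t ≤ ∫ t in (0 : ℝ)..S, (1 - G t) := by
      refine intervalIntegral.integral_mono_on hS
        ((intervalIntegrable_const.sub (hGi 0 S)).mul_continuousOn
          hr.continuous_surv.continuousOn) (intervalIntegrable_const.sub (hGi 0 S)) fun t ht => ?_
      exact mul_le_of_le_one_right (sub_nonneg.2 (h1 t)) (hr.surv_le_one ht.1)
    have h4 : ∫ t in (0 : ℝ)..S, (1 - G t) * surv r t =
        (∫ t in (0 : ℝ)..S, surv r t) - ∫ t in (0 : ℝ)..S, G t * surv r t := by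
      rw [← intervalIntegral.integral_sub (hsi 0 S) hGs]
      exact intervalIntegral.integral_congr fun t _ => by ring
    have h5 := mul_nonneg hS (surv_pos r S).le
    linarith
  rw [lintegral_Ioc_ofReal hS (hsi 0 S) fun t _ => (surv_pos r t).le]
  calc ENNReal.ofReal (∫ t in (0 : ℝ)..S, surv r t)
      ≤ ENNReal.ofReal (2 * ∫ t in (0 : ℝ)..S, (1 - G t)) := ENNReal.ofReal_le_ofReal h2
    _ = 2 * ∫⁻ t in Ioc 0 S, ENNReal.ofReal (1 - G t) := by
      rw [ENNReal.ofReal_mul zero_le_two, lintegral_Ioc_ofReal hS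
        (intervalIntegrable_const.sub (hGi 0 S)) fun t _ => sub_nonneg.2 (h1 t)]
      simp
    _ ≤ _ := by gcongr; exact Ioc_subset_Ioi_self

/-! ### Tail estimates for `q` with `t² q(t)` increasing -/

theorem lintegral_Ioi_comp_mul_left {F : ℝ → ℝ≥0∞} (hF : Measurable F) {a : ℝ} (ha : 0 < a) (u : ℝ) :
    ∫⁻ s in Ioi (a * u), F s = ENNReal.ofReal a * ∫⁻ s in Ioi u, F (a * s) := by
  have h1 : ENNReal.ofReal a • Measure.map (a * ·) (volume : Measure ℝ) = volume := by
    simpa only [abs_of_pos ha] using Real.smul_map_volume_mul_left ha.ne'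
  conv_lhs => rw [← h1]
  rw [Measure.restrict_smul, lintegral_smul_measure, smul_eq_mul, setLIntegral_map measurableSet_Ioi hF
    (measurable_const_mul a)]
  congr 3
  ext s
  exact mul_lt_mul_iff_right₀ ha

theorem lintegral_Ioi_rpow_neg {p m : ℝ} (hp : 1 < p) (hm : 0 < m) :
    ∫⁻ s in Ioi m, ENNReal.ofReal (s ^ (-p)) = ENNReal.ofReal (m ^ (1 - p) / (p - 1)) := by
  rw [← ofReal_integral_eq_lintegral_ofReal (integrableOn_Ioi_rpow_of_lt (by linarith) hm),
    integral_Ioi_rpow_of_lt (by linarith) hm]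
  · congr 1
    rw [show -p + 1 = -(p - 1) by ring, show 1 - p = -(p - 1) by ring, neg_div_neg_eq]
  · refine (ae_restrict_iff' measurableSet_Ioi).2 (ae_of_all _ fun s hs => ?_)
    exact Real.rpow_nonneg (hm.trans hs).le _

theorem lintegral_Ioi_one_div_sq {m : ℝ} (hm : 0 < m) :
    ∫⁻ s in Ioi m, ENNReal.ofReal (1 / s ^ 2) = ENNReal.ofReal (1 / m) := by
  have h := lintegral_Ioi_rpow_neg (p := 2) (by norm_num) hm
  norm_num [Real.rpow_neg_one] at h
  rw [one_div, ← h]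
  exact setLIntegral_congr_fun measurableSet_Ioi fun s _ => by rw [one_div]

theorem lintegral_Ioi_one_div_cube {m : ℝ} (hm : 0 < m) :
    ∫⁻ s in Ioi m, ENNReal.ofReal (1 / s ^ 3) = ENNReal.ofReal (1 / (2 * m ^ 2)) := by
  have h := lintegral_Ioi_rpow_neg (p := 3) (by norm_num) hm
  have e : m ^ ((1 : ℝ) - 3) / (3 - 1) = 1 / (2 * m ^ 2) := by
    rw [show (1 : ℝ) - 3 = -2 by norm_num, Real.rpow_neg hm.le]
    norm_num
    ring
  rw [← e, ← h]
  refine setLIntegral_congr_fun measurableSet_Ioi fun s hs => ?_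
  have hs' : (0 : ℝ) < s := hm.trans hs
  rw [Real.rpow_neg hs'.le, one_div]
  norm_num

theorem lintegral_Ioo_one_div_sq {a b : ℝ} (ha : 0 < a) (hab : a ≤ b) :
    ∫⁻ s in Ioo a b, ENNReal.ofReal (1 / s ^ 2) = ENNReal.ofReal (1 / a - 1 / b) := by
  have h0 : ∀ s ∈ uIcc a b, s ≠ 0 := fun s hs => by
    rw [uIcc_of_le hab] at hs
    exact (ha.trans_le hs.1).ne'
  have hc : ContinuousOn (fun s : ℝ => 1 / s ^ 2) (uIcc a b) :=
    continuousOn_const.div (continuousOn_id.pow 2) fun s hs => pow_ne_zero 2 (h0 s hs)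
  rw [setLIntegral_congr Ioo_ae_eq_Ioc, lintegral_Ioc_ofReal hab hc.intervalIntegrable
    fun s _ => by positivity]
  congr 1
  rw [intervalIntegral.integral_eq_sub_of_hasDerivAt (f := fun s => -(1 / s)) _
    hc.intervalIntegrable]
  · ring
  · intro s hs
    have h : HasDerivAt (fun s : ℝ => -s⁻¹) _ s := (hasDerivAt_inv (h0 s hs)).neg
    simpa only [one_div, neg_neg] using h

/-- Substituting `s ↦ (u / m) s` in the right-hand tail reduces this to the pointwise bound `q s ≤
(u / m)² q((u / m) s)`. -/
theorem tail_scale {q : ℝ → ℝ} (hq : Measurable q)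
    (hmono : ∀ s t, 0 < s → s ≤ t → s ^ 2 * q s ≤ t ^ 2 * q t)
    {m u : ℝ} (hm : 0 < m) (hmu : m ≤ u) :
    ENNReal.ofReal (m / u) * ∫⁻ s in Ioi m, ENNReal.ofReal (q s) ≤
      ∫⁻ s in Ioi u, ENNReal.ofReal (q s) := by
  have hu : 0 < u := hm.trans_le hmu
  have hum : 0 < u / m := by positivity
  have h := lintegral_Ioi_comp_mul_left hq.ennreal_ofReal hum m
  rw [div_mul_cancel₀ _ hm.ne'] at h
  rw [h, ← lintegral_const_mul' _ _ ENNReal.ofReal_ne_top, ← lintegral_const_mul' _ _ ENNReal.ofReal_ne_top]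
  refine setLIntegral_mono' measurableSet_Ioi fun s hs => ?_
  have hs' : 0 < s := hm.trans hs
  rw [← ENNReal.ofReal_mul (by positivity), ← ENNReal.ofReal_mul hum.le]
  refine ENNReal.ofReal_le_ofReal ?_
  have h1 := hmono s (u / m * s) hs' (le_mul_of_one_le_left hs'.le ((one_le_div hm).2 hmu))
  have h2 : q s ≤ (u / m) ^ 2 * q (u / m * s) := by
    rw [mul_pow, mul_comm ((u / m) ^ 2), mul_assoc] at h1
    exact le_of_mul_le_mul_left h1 (by positivity)
  calc m / u * q s ≤ m / u * ((u / m) ^ 2 * q (u / m * s)) := by gcongr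
    _ = u / m * q (u / m * s) := by field_simp

/-- Beyond `t`, `q` dominates the function `t² q(t) / s²`, whose tail integral is exactly `t q(t)`.
This pays for stopping early. -/
theorem mul_le_tail {q : ℝ → ℝ} (hpos : ∀ t, 0 ≤ q t)
    (hmono : ∀ s t, 0 < s → s ≤ t → s ^ 2 * q s ≤ t ^ 2 * q t)
    {t : ℝ} (ht : 0 < t) :
    ENNReal.ofReal (t * q t) ≤ ∫⁻ s in Ioi t, ENNReal.ofReal (q s) := by
  calc ENNReal.ofReal (t * q t) = ENNReal.ofReal (t ^ 2 * q t) * ENNReal.ofReal (1 / t) := by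
        rw [← ENNReal.ofReal_mul (mul_nonneg (by positivity) (hpos t))]
        congr 1; field_simp
    _ = ∫⁻ s in Ioi t, ENNReal.ofReal (t ^ 2 * q t) * ENNReal.ofReal (1 / s ^ 2) := by
        rw [lintegral_const_mul' _ _ ENNReal.ofReal_ne_top, lintegral_Ioi_one_div_sq ht]
    _ ≤ _ := by
        refine setLIntegral_mono' measurableSet_Ioi fun s hs => ?_
        have hs' : 0 < s := ht.trans hs
        rw [← ENNReal.ofReal_mul (mul_nonneg (by positivity) (hpos t))]
        refine ENNReal.ofReal_le_ofReal ?_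
        rw [mul_one_div, div_le_iff₀ (by positivity)]
        linarith [hmono t s ht (le_of_lt hs)]

/-- Equality holds for `q = p / s²`. In general `s² q(s) - p`, with `p` the value of `s² q(s)` at `s
= 2 m`, has the sign of `s - 2 m`, while `1 / s - 1 / (2 m)` has the opposite sign, so their product
is nonpositive: a Chebyshev-type comparison. -/
theorem lintegral_div_le_tail {q : ℝ → ℝ} (hpos : ∀ t, 0 ≤ q t)
    (hmono : ∀ s t, 0 < s → s ≤ t → s ^ 2 * q s ≤ t ^ 2 * q t)
    {m : ℝ} (hm : 0 < m) :
    ∫⁻ s in Ioi m, ENNReal.ofReal (q s / s) ≤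
      ENNReal.ofReal (1 / (2 * m)) * ∫⁻ s in Ioi m, ENNReal.ofReal (q s) := by
  set p := (2 * m) ^ 2 * q (2 * m) with hp
  have hp0 : 0 ≤ p := mul_nonneg (by positivity) (hpos _)
  have h1 : ∀ s, 0 < s → q s / s + p * (1 / (2 * m) * (1 / s ^ 2)) ≤
      1 / (2 * m) * q s + p * (1 / s ^ 3) := by
    intro s hs
    have h2 : (s ^ 2 * q s - p) * (2 * m - s) ≤ 0 := by
      rcases le_total s (2 * m) with h | h
      · exact mul_nonpos_of_nonpos_of_nonneg (sub_nonpos.2 (hmono _ _ hs h)) (sub_nonneg.2 h)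
      · exact mul_nonpos_of_nonneg_of_nonpos (sub_nonneg.2 (hmono _ _ (by positivity) h))
          (sub_nonpos.2 h)
    have h3 : q s / s + p * (1 / (2 * m) * (1 / s ^ 2)) -
        (1 / (2 * m) * q s + p * (1 / s ^ 3)) =
        (s ^ 2 * q s - p) * (2 * m - s) / (2 * m * s ^ 3) := by
      field_simp
      ring
    have h4 := div_nonpos_of_nonpos_of_nonneg h2 (by positivity : 0 ≤ 2 * m * s ^ 3)
    linarith
  have hM : ∀ k : ℕ, Measurable fun s : ℝ => ENNReal.ofReal (1 / s ^ k) := fun k =>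
    (measurable_const.div (measurable_id.pow_const k)).ennreal_ofReal
  -- The finite number `p / (2 m²)` is both `∫ p / s³` and `(1 / (2 m)) ∫ p / s²` over `(m, ∞)`. It
  -- is added on both sides and cancelled, which avoids subtraction in `ℝ≥0∞`.
  have h5 : (∫⁻ s in Ioi m, ENNReal.ofReal (q s / s)) + ENNReal.ofReal (p / (2 * m ^ 2)) ≤
      (ENNReal.ofReal (1 / (2 * m)) * ∫⁻ s in Ioi m, ENNReal.ofReal (q s)) +
        ENNReal.ofReal (p / (2 * m ^ 2)) := by
    calc _ = ∫⁻ s in Ioi m, (ENNReal.ofReal (q s / s) +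
          ENNReal.ofReal (p * (1 / (2 * m))) * ENNReal.ofReal (1 / s ^ 2)) := by
          rw [lintegral_add_right _ ((hM 2).const_mul _),
            lintegral_const_mul' _ _ ENNReal.ofReal_ne_top, lintegral_Ioi_one_div_sq hm,
            ← ENNReal.ofReal_mul (by positivity)]
          congr 2
          field_simp
      _ ≤ ∫⁻ s in Ioi m, (ENNReal.ofReal (1 / (2 * m)) * ENNReal.ofReal (q s) +
          ENNReal.ofReal p * ENNReal.ofReal (1 / s ^ 3)) := by
          refine setLIntegral_mono' measurableSet_Ioi fun s hs => ?_
          have hs' : 0 < s := hm.trans hs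
          rw [← ENNReal.ofReal_mul (by positivity), ← ENNReal.ofReal_mul (by positivity),
            ← ENNReal.ofReal_mul hp0, ← ENNReal.ofReal_add (div_nonneg (hpos s) hs'.le) (by positivity),
            ← ENNReal.ofReal_add (mul_nonneg (by positivity) (hpos s)) (by positivity)]
          refine ENNReal.ofReal_le_ofReal ?_
          rw [mul_assoc]
          exact h1 s hs'
      _ = _ := by
          rw [lintegral_add_right _ ((hM 3).const_mul _),
            lintegral_const_mul' _ _ ENNReal.ofReal_ne_top,
            lintegral_const_mul' _ _ ENNReal.ofReal_ne_top, lintegral_Ioi_one_div_cube hm,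
            ← ENNReal.ofReal_mul hp0, mul_one_div]
  exact (ENNReal.add_le_add_iff_right ENNReal.ofReal_ne_top).1 h5

/-- Delaying a free stop by `v ≤ m` costs at least as much as a volume `v` at the stop. -/
theorem volume_le_delay {q : ℝ → ℝ} (hq : Measurable q) (hpos : ∀ t, 0 ≤ q t)
    (hmono : ∀ s t, 0 < s → s ≤ t → s ^ 2 * q s ≤ t ^ 2 * q t)
    {m v : ℝ} (hm : 0 < m) (hv : 0 ≤ v) (hvm : v ≤ m) :
    ENNReal.ofReal v * ∫⁻ s in Ioi m, ENNReal.ofReal (q s / s) ≤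
      ∫⁻ u in Ioo m (m + v), ENNReal.ofReal (1 / u) * ∫⁻ s in Ioi u, ENNReal.ofReal (q s) := by
  set T := ∫⁻ s in Ioi m, ENNReal.ofReal (q s)
  calc _ ≤ ENNReal.ofReal v * (ENNReal.ofReal (1 / (2 * m)) * T) := by
        gcongr; exact lintegral_div_le_tail hpos hmono hm
    -- The new coefficient is `v / (m + v)`, which is at least `v / (2 m)` because `v ≤ m`.
    _ ≤ ENNReal.ofReal m * ENNReal.ofReal (1 / m - 1 / (m + v)) * T := by
        rw [← mul_assoc, ← ENNReal.ofReal_mul hv, ← ENNReal.ofReal_mul hm.le]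
        refine mul_le_mul_left (ENNReal.ofReal_le_ofReal ?_) T
        rw [div_sub_div _ _ hm.ne' (by positivity), ← mul_div_assoc, ← mul_div_assoc,
          div_le_div_iff₀ (by positivity) (by positivity)]
        have : 0 ≤ v * m * (m - v) := by
          have := sub_nonneg.2 hvm
          positivity
        nlinarith
    _ = ∫⁻ u in Ioo m (m + v), ENNReal.ofReal m * T * ENNReal.ofReal (1 / u ^ 2) := by
        have hM : Measurable fun u : ℝ => ENNReal.ofReal (1 / u ^ 2) :=
          (measurable_const.div (measurable_id.pow_const 2)).ennreal_ofReal
        rw [lintegral_const_mul _ hM, lintegral_Ioo_one_div_sq hm (by linarith)]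
        ring
    _ ≤ _ := by
        refine setLIntegral_mono' measurableSet_Ioo fun u hu => ?_
        have hu' : 0 < u := hm.trans hu.1
        calc ENNReal.ofReal m * T * ENNReal.ofReal (1 / u ^ 2)
            = ENNReal.ofReal (1 / u) * (ENNReal.ofReal (m / u) * T) := by
              rw [← mul_assoc, ← ENNReal.ofReal_mul (by positivity), mul_right_comm,
                ← ENNReal.ofReal_mul hm.le]
              congr 2
              field_simp
          _ ≤ _ := by gcongr; exact tail_scale hq hmono hm hu.1.le

/-- `volume_le_delay`, averaged over the starting times `m` that are distributed as `z`. -/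
theorem lintegral_volume_le_delay {q : ℝ → ℝ} (hq : Measurable q) (hpos : ∀ t, 0 ≤ q t)
    (hmono : ∀ s t, 0 < s → s ≤ t → s ^ 2 * q s ≤ t ^ 2 * q t) {z : ℝ → ℝ} (hz : Monotone z)
    {δ v : ℝ} (hδ : 0 < δ) (hv : 0 ≤ v) (hz0 : ∀ t < δ + v, z t = 0) :
    ENNReal.ofReal v * ∫⁻ s in Ioi (0 : ℝ), ENNReal.ofReal (z s) * ENNReal.ofReal (q s / s) ≤
      ∫⁻ u in Ioi (0 : ℝ), ENNReal.ofReal (z u - z (u - v)) *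
        (ENNReal.ofReal (1 / u) * ∫⁻ s in Ioi u, ENNReal.ofReal (q s)) := by
  set R : ℝ → ℝ≥0∞ := fun u => ENNReal.ofReal (1 / u) * ∫⁻ s in Ioi u, ENNReal.ofReal (q s)
  have hR : Measurable R := by
    refine (measurable_const.div measurable_id).ennreal_ofReal.mul (Antitone.measurable ?_)
    exact fun a b hab => lintegral_mono_set (Ioi_subset_Ioi hab)
  have hB : Measurable fun s => ENNReal.ofReal (q s / s) := (hq.div measurable_id).ennreal_ofReal
  have layer : ∀ a b : ℝ, ENNReal.ofReal (b - a) = ∫⁻ y, (Ico a b).indicator 1 y := fun a b => by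
    rw [lintegral_indicator_one measurableSet_Ico, Real.volume_Ico]
  have hzm : Measurable fun p : ℝ × ℝ => z p.1 := hz.measurable.comp measurable_fst
  have hzm' : Measurable fun p : ℝ × ℝ => z (p.1 - v) :=
    hz.measurable.comp (measurable_fst.sub_const v)
  have meas : ∀ (a b : ℝ × ℝ → ℝ), Measurable a → Measurable b →
      Measurable fun p : ℝ × ℝ => (Ico (a p) (b p)).indicator (1 : ℝ → ℝ≥0∞) p.2 := by
    intro a b ha hb
    have : MeasurableSet {p : ℝ × ℝ | a p ≤ p.2 ∧ p.2 < b p} :=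
      (measurableSet_le ha measurable_snd).inter (measurableSet_lt measurable_snd hb)
    exact (measurable_one.indicator this)
  -- Layer cake in the values of `z`: at level `y`, the function `z` becomes the step function
  -- starting at `m = inf {u | y < z u}`, and `z u - z (u - v)` becomes the window of length `v`
  -- after `m`. Here `v ≤ m` because `z` vanishes below `δ + v`.
  have e1 : ∫⁻ s in Ioi (0 : ℝ), ENNReal.ofReal (z s) * ENNReal.ofReal (q s / s) =
      ∫⁻ y, ∫⁻ s in Ioi (0 : ℝ), (Ico 0 (z s)).indicator 1 y * ENNReal.ofReal (q s / s) := by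
    rw [lintegral_lintegral_swap]
    · refine lintegral_congr fun s => ?_
      rw [lintegral_mul_const' _ _ ENNReal.ofReal_ne_top, ← layer, sub_zero]
    · exact (((meas _ _ measurable_const hzm).comp measurable_swap).mul
        (hB.comp measurable_snd)).aemeasurable
  have e2 : ∫⁻ u in Ioi (0 : ℝ), ENNReal.ofReal (z u - z (u - v)) * R u =
      ∫⁻ y, ∫⁻ u in Ioi (0 : ℝ), (Ico (z (u - v)) (z u)).indicator 1 y * R u := by
    rw [lintegral_lintegral_swap]
    · refine lintegral_congr fun u => ?_
      rw [lintegral_mul_const _ (measurable_one.indicator measurableSet_Ico), ← layer]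
    · exact (((meas _ _ hzm' hzm).comp measurable_swap).mul (hR.comp measurable_snd)).aemeasurable
  rw [e1, e2, ← lintegral_const_mul' _ _ ENNReal.ofReal_ne_top]
  refine lintegral_mono fun y => ?_
  rcases lt_or_ge y 0 with hy | hy
  · have : ∀ s, (Ico 0 (z s)).indicator (1 : ℝ → ℝ≥0∞) y = 0 := fun s =>
      indicator_of_notMem (fun h => absurd h.1 (not_le.2 hy)) _
    simp [this]
  set S := {u | y < z u} with hS
  rcases S.eq_empty_or_nonempty with hSe | hSne
  · have : ∀ s, (Ico 0 (z s)).indicator (1 : ℝ → ℝ≥0∞) y = 0 := fun s =>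
      indicator_of_notMem (fun h => hSe.subset (show s ∈ S from h.2)) _
    simp [this]
  have hlow : ∀ s ∈ S, δ + v ≤ s := fun s hs => by
    by_contra h
    have h1 : y < z s := hs
    rw [hz0 s (not_le.1 h)] at h1
    exact absurd h1 (not_lt.2 hy)
  set m := sInf S
  have hbdd : BddBelow S := ⟨_, hlow⟩
  have hmv : δ + v ≤ m := le_csInf hSne hlow
  have hm : 0 < m := by linarith
  have hgt : ∀ u, m < u → y < z u := fun u hu => by
    obtain ⟨s, hs, hsu⟩ := exists_lt_of_csInf_lt hSne hu
    exact lt_of_lt_of_le hs (hz hsu.le)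
  have hlt : ∀ u, u < m → z u ≤ y := fun u hu => by
    by_contra h
    exact absurd (csInf_le hbdd (show u ∈ S from not_le.1 h)) (not_le.2 hu)
  calc ENNReal.ofReal v *
        ∫⁻ s in Ioi (0 : ℝ), (Ico 0 (z s)).indicator 1 y * ENNReal.ofReal (q s / s)
      ≤ ENNReal.ofReal v * ∫⁻ s in Ioi m, ENNReal.ofReal (q s / s) := by
        refine mul_le_mul_right ?_ _
        rw [setLIntegral_congr (Ioi_ae_eq_Ici (a := m)),
          ← lintegral_indicator measurableSet_Ioi, ← lintegral_indicator measurableSet_Ici]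
        refine lintegral_mono fun s => ?_
        by_cases hs : m ≤ s
        · rw [indicator_of_mem (show s ∈ Ioi (0 : ℝ) from hm.trans_le hs), indicator_of_mem (mem_Ici.2 hs)]
          refine mul_le_of_le_one_left' ?_
          exact indicator_le_self' (fun _ _ => zero_le) y
        · have h0 : (Ico 0 (z s)).indicator (1 : ℝ → ℝ≥0∞) y = 0 :=
            indicator_of_notMem (fun h => absurd h.2 (not_lt.2 (hlt s (not_le.1 hs)))) _
          refine (indicator_le_self' (fun _ _ => zero_le) s).trans ?_
          simp [h0]
    _ ≤ ∫⁻ u in Ioo m (m + v), R u := volume_le_delay hq hpos hmono hm hv (by linarith)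
    _ ≤ _ := by
        rw [← lintegral_indicator measurableSet_Ioi, ← lintegral_indicator measurableSet_Ioo]
        refine lintegral_mono fun u => ?_
        by_cases hu : u ∈ Ioo m (m + v)
        · rw [indicator_of_mem (show u ∈ Ioi (0 : ℝ) from hm.trans hu.1), indicator_of_mem hu,
            indicator_of_mem (s := Ico (z (u - v)) (z u))
              ⟨hlt _ (by linarith [hu.2]), hgt u hu.1⟩]
          simp
        · rw [indicator_of_notMem hu]
          exact zero_le

/-- From `s` to `t` the accumulated hazard is at most `2 log (t / s)`, so survival falls by a factor
of at least `(s / t)²`. -/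
theorem sq_mul_surv_le {r : ℝ → ℝ} (hr : IsRate r) (h2 : ∀ t, 0 < t → r t ≤ 2 / t) {s t : ℝ}
    (hs : 0 < s) (hst : s ≤ t) : s ^ 2 * surv r s ≤ t ^ 2 * surv r t := by
  have ht : 0 < t := hs.trans_le hst
  have h0 : ∀ u ∈ uIcc s t, u ≠ 0 := fun u hu => by
    rw [uIcc_of_le hst] at hu
    exact (hs.trans_le hu.1).ne'
  have h3 : ∫ u in s..t, r u ≤ 2 * Real.log (t / s) := by
    rw [← integral_one_div_of_pos hs ht, ← intervalIntegral.integral_const_mul]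
    refine intervalIntegral.integral_mono_on hst (hr.intervalIntegrable s t)
      ((ContinuousOn.intervalIntegrable (continuousOn_const.div continuousOn_id h0)).const_mul 2)
      fun u hu => ?_
    rw [mul_one_div]
    exact h2 u (hs.trans_le hu.1)
  have h4 : (s / t) ^ 2 ≤ Real.exp (-∫ u in s..t, r u) := by
    have h5 : (s / t) ^ 2 = Real.exp (-(2 * Real.log (t / s))) := by
      rw [Real.exp_neg, two_mul, Real.exp_add, Real.exp_log (by positivity)]
      field_simp
    rw [h5]
    exact Real.exp_le_exp.2 (neg_le_neg h3)
  rw [hr.surv_eq s t]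
  have h6 := surv_pos r s
  calc s ^ 2 * surv r s = t ^ 2 * (surv r s * (s / t) ^ 2) := by field_simp
    _ ≤ _ := by gcongr

theorem lintegral_mul_primitive {q d : ℝ → ℝ≥0∞} (hq : Measurable q) (hd : Measurable d) :
    ∫⁻ t in Ioi (0 : ℝ), q t * ∫⁻ u in Ioc 0 t, d u =
      ∫⁻ u in Ioi (0 : ℝ), d u * ∫⁻ t in Ioi u, q t := by
  have h1 : ∀ t, ∫⁻ u in Ioc 0 t, d u = ∫⁻ u in Ioi (0 : ℝ), (Ioi u).indicator 1 t * d u := fun t => by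
    rw [← setLIntegral_congr Ioo_ae_eq_Ioc, ← lintegral_indicator measurableSet_Ioi,
      ← lintegral_indicator measurableSet_Ioo]
    refine lintegral_congr fun u => ?_
    by_cases h0 : 0 < u <;> by_cases hu : u < t <;> simp [indicator, h0, hu]
  have h2 : ∀ u ∈ Ioi (0 : ℝ), ∫⁻ t in Ioi u, q t =
      ∫⁻ t in Ioi (0 : ℝ), (Ioi u).indicator 1 t * q t := fun u hu => by
    rw [← lintegral_indicator measurableSet_Ioi, ← lintegral_indicator measurableSet_Ioi]
    refine lintegral_congr fun t => ?_
    have hu' : 0 < u := hu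
    by_cases ht : u < t
    · simp [indicator, ht, hu'.trans ht]
    · simp [indicator, ht]
  have hm : Measurable fun p : ℝ × ℝ => (Ioi p.2).indicator (1 : ℝ → ℝ≥0∞) p.1 :=
    measurable_one.indicator (measurableSet_lt measurable_snd measurable_fst)
  have hm1 : ∀ u : ℝ, Measurable ((Ioi u).indicator (1 : ℝ → ℝ≥0∞)) := fun u =>
    measurable_one.indicator measurableSet_Ioi
  have hm2 : ∀ t : ℝ, Measurable fun u : ℝ => (Ioi u).indicator (1 : ℝ → ℝ≥0∞) t := fun t =>
    hm.comp (measurable_const.prodMk measurable_id)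
  calc _ = ∫⁻ t in Ioi (0 : ℝ), ∫⁻ u in Ioi (0 : ℝ), q t * ((Ioi u).indicator 1 t * d u) := by
        refine lintegral_congr fun t => ?_
        have hm3 : Measurable fun u : ℝ => (Ioi u).indicator (1 : ℝ → ℝ≥0∞) t * d u := (hm2 t).mul hd
        rw [h1, lintegral_const_mul _ hm3]
    _ = ∫⁻ u in Ioi (0 : ℝ), ∫⁻ t in Ioi (0 : ℝ), q t * ((Ioi u).indicator 1 t * d u) := by
        refine lintegral_lintegral_swap (Measurable.aemeasurable ?_)
        exact (hq.comp measurable_fst).mul (hm.mul (hd.comp measurable_snd))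
    _ = _ := by
        refine setLIntegral_congr_fun measurableSet_Ioi fun u hu => ?_
        have hm3 : Measurable fun t : ℝ => (Ioi u).indicator (1 : ℝ → ℝ≥0∞) t * q t := (hm1 u).mul hq
        rw [h2 u hu, ← lintegral_const_mul _ hm3]
        exact lintegral_congr fun t => by ring

/-- The cost of stopping at the rates `2 z i (t) / t`, where the stop at box `i` has the volume `v i`,
is at most the cost with free stops that are delayed by `v i`. -/
theorem lintegral_surv_add_volume_le {n : ℕ} {v : Fin n → ℝ} (hv : ∀ i, 0 ≤ v i)
    {z : Fin n → ℝ → ℝ} (hz : ∀ i, Monotone (z i)) {δ : ℝ} (hδ : 0 < δ)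
    (hz0 : ∀ i, ∀ t < δ + v i, z i t = 0) (hz1 : ∀ t, ∑ i, z i t ≤ 1) :
    (∫⁻ t in Ioi (0 : ℝ), ENNReal.ofReal (surv (fun u => 2 / u * ∑ i, z i u) t)) +
      ∑ i, ENNReal.ofReal (v i) * ∫⁻ t in Ioi (0 : ℝ),
        ENNReal.ofReal (2 / t * z i t * surv (fun u => 2 / u * ∑ i, z i u) t) ≤
      2 * ∫⁻ t in Ioi (0 : ℝ), ENNReal.ofReal (1 - ∑ i, z i (t - v i)) := by
  set G : ℝ → ℝ := fun t => ∑ i, z i t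
  set G' : ℝ → ℝ := fun t => ∑ i, z i (t - v i)
  have hG : Monotone G := fun a b hab => Finset.sum_le_sum fun i _ => hz i hab
  have hG' : Monotone G' := fun a b hab => Finset.sum_le_sum fun i _ => hz i (by linarith)
  have hG'G : ∀ t, G' t ≤ G t := fun t => Finset.sum_le_sum fun i _ => hz i (by linarith [hv i])
  have hG0 : ∀ t < δ, G t = 0 := fun t ht => Finset.sum_eq_zero fun i _ =>
    hz0 i t (by linarith [hv i])
  have hG'0 : ∀ t < δ, G' t = 0 := fun t ht => Finset.sum_eq_zero fun i _ =>
    hz0 i _ (by linarith [hv i])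
  have hG'1 : ∀ t, G' t ≤ 1 := fun t => (hG'G t).trans (hz1 t)
  set r : ℝ → ℝ := fun u => 2 / u * G u
  set r' : ℝ → ℝ := fun u => 2 / u * G' u
  have hr : IsRate r := isRate_two_div_mul hG hδ hG0 hz1
  have hr' : IsRate r' := isRate_two_div_mul hG' hδ hG'0 hG'1
  have hr'r : ∀ t, r' t ≤ r t := fun t => by
    rcases lt_or_ge t δ with h | h
    · simp [r, r', hG0 t h, hG'0 t h]
    · have : 0 < t := by linarith
      exact mul_le_mul_of_nonneg_left (hG'G t) (by positivity)
  have hd : IsRate fun t => r t - r' t := hr.sub hr' hr'r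
  set q := surv r
  have hqm : Measurable q := hr.continuous_surv.measurable
  have hpos : ∀ t, 0 ≤ q t := fun t => (surv_pos r t).le
  have hmono : ∀ s t, 0 < s → s ≤ t → s ^ 2 * q s ≤ t ^ 2 * q t := fun s t hs hst =>
    sq_mul_surv_le hr (fun t ht => mul_le_of_le_one_right (by positivity) (hz1 t)) hs hst
  refine le_trans ?_ (lintegral_surv_le hG' hδ hG'0 hG'1)
  have hmd : Measurable fun u => ENNReal.ofReal (r u - r' u) := hd.measurable.ennreal_ofReal
  have hmQ : Measurable fun u => ENNReal.ofReal (1 / u) * ∫⁻ s in Ioi u, ENNReal.ofReal (q s) := by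
    refine (measurable_const.div measurable_id).ennreal_ofReal.mul (Antitone.measurable ?_)
    exact fun a b hab => lintegral_mono_set (Ioi_subset_Ioi hab)
  -- The volumes are bounded separately for each box. Summed, they give `∫ (r - r')(u) ∫_u^∞ q`,
  -- which by Tonelli is `∫ q(t) D(t)` with `D(t) = ∫_0^t (r - r')`.
  calc _ ≤ (∫⁻ t in Ioi (0 : ℝ), ENNReal.ofReal (q t)) + ∑ i, 2 *
        ∫⁻ u in Ioi (0 : ℝ), ENNReal.ofReal (z i u - z i (u - v i)) *
          (ENNReal.ofReal (1 / u) * ∫⁻ s in Ioi u, ENNReal.ofReal (q s)) := by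
        refine add_le_add le_rfl (Finset.sum_le_sum fun i _ => ?_)
        have h1 := lintegral_volume_le_delay hqm hpos hmono (hz i) hδ (hv i) (hz0 i)
        refine le_trans (le_of_eq ?_) (mul_le_mul_right h1 2)
        rw [mul_left_comm, ← lintegral_const_mul' _ _ ENNReal.ofNat_ne_top]
        congr 1
        refine setLIntegral_congr_fun measurableSet_Ioi fun t ht => ?_
        have ht' : 0 < t := ht
        rw [← ENNReal.ofReal_ofNat 2, ← ENNReal.ofReal_mul' (div_nonneg (hpos t) ht'.le),
          ← ENNReal.ofReal_mul zero_le_two]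
        congr 1
        ring
    _ = (∫⁻ t in Ioi (0 : ℝ), ENNReal.ofReal (q t)) +
        ∫⁻ u in Ioi (0 : ℝ), ENNReal.ofReal (r u - r' u) * ∫⁻ s in Ioi u, ENNReal.ofReal (q s) := by
        congr 1
        simp_rw [← lintegral_const_mul' 2 _ ENNReal.ofNat_ne_top]
        rw [← lintegral_finsetSum]
        · refine setLIntegral_congr_fun measurableSet_Ioi fun u hu => ?_
          have hu' : 0 < u := hu
          simp only [← mul_assoc]
          rw [← Finset.sum_mul, ← Finset.sum_mul, ← Finset.mul_sum,
            ← ENNReal.ofReal_sum_of_nonneg fun i _ => sub_nonneg.2 (hz i (by linarith [hv i])),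
            ← ENNReal.ofReal_ofNat 2, ← ENNReal.ofReal_mul zero_le_two,
            ← ENNReal.ofReal_mul' (by positivity), Finset.sum_sub_distrib]
          congr 2
          simp only [r, r', G, G']
          ring
        · intro i _
          exact ((((hz i).measurable.sub ((hz i).measurable.comp
            (measurable_id.sub_const _))).ennreal_ofReal).mul hmQ).const_mul 2
    _ = ∫⁻ t in Ioi (0 : ℝ), (ENNReal.ofReal (q t) +
        ENNReal.ofReal (q t) * ∫⁻ u in Ioc 0 t, ENNReal.ofReal (r u - r' u)) := by
        rw [← lintegral_mul_primitive hqm.ennreal_ofReal hmd, lintegral_add_left hqm.ennreal_ofReal]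
    _ ≤ _ := by
        refine setLIntegral_mono' measurableSet_Ioi fun t ht => ?_
        have ht' : 0 ≤ t := le_of_lt ht
        rw [lintegral_Ioc_ofReal ht' (hd.intervalIntegrable 0 t) fun u _ => hd.nonneg u,
          ← ENNReal.ofReal_mul (hpos t), ← ENNReal.ofReal_add (hpos t) (mul_nonneg (hpos t)
            (intervalIntegral.integral_nonneg ht' fun u _ => hd.nonneg u))]
        refine ENNReal.ofReal_le_ofReal ?_
        -- Pointwise `q (1 + D) ≤ q exp D = surv r'`, the survival function of the delayed free
        -- stops.
        have h1 := surv_sub hr hr' t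
        have h2 : (∫ u in (0 : ℝ)..t, (r u - r' u)) + 1 ≤
            Real.exp (∫ u in (0 : ℝ)..t, (r u - r' u)) := Real.add_one_le_exp _
        have h3 : q t * Real.exp (∫ u in (0 : ℝ)..t, (r u - r' u)) = surv r' t := by
          rw [show q t = _ from h1.symm, surv.eq_1 (fun t => r t - r' t), mul_assoc, ← Real.exp_add]
          simp
        rw [← h3]
        have := mul_le_mul_of_nonneg_left h2 (hpos t)
        linarith

/-! ### Caps, arrival rates and their thinning -/

/-- Increasing functions can be capped so that their sum is capped at `1`. -/
theorem exists_caps {n : ℕ} {Y : Fin n → ℝ → ℝ} (hY : ∀ i, Monotone (Y i))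
    (hY0 : ∀ i, ∀ t < 0, Y i t = 0) (hY1 : ∀ i t, Y i t ≤ 1) :
    ∃ L : Fin n → ℝ, (∀ i, 0 ≤ L i) ∧ ∑ i, L i ≤ 1 ∧
      ∀ᵐ s : ℝ, min 1 (∑ i, Y i s) ≤ ∑ i, min (Y i s) (L i) := by
  have hnn : ∀ i t, 0 ≤ Y i t := fun i t => by
    rcases lt_or_ge t 0 with h | h
    · exact (hY0 i t h).ge
    · exact (hY0 i (-1) (by norm_num)).symm.le.trans (hY i (by linarith))
  -- If the sum stays below 1, the suprema serve as caps. Otherwise let `T` be the time when the sum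
  -- reaches 1; it may jump over 1 at `T`, so the caps interpolate between the left and right limits
  -- at `T`.
  by_cases hall : ∀ s, ∑ i, Y i s < 1
  · have hb : ∀ i, BddAbove (range (Y i)) := fun i => ⟨1, by rintro _ ⟨t, rfl⟩; exact hY1 i t⟩
    refine ⟨fun i => ⨆ s, Y i s, fun i => (hnn i 0).trans (le_ciSup (hb i) 0), ?_, ?_⟩
    · exact le_of_tendsto' (tendsto_finsetSum _ fun i _ => tendsto_atTop_ciSup (hY i) (hb i))
        fun s => (hall s).le
    · refine ae_of_all _ fun s => (min_le_right _ _).trans (Finset.sum_le_sum fun i _ => ?_)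
      exact le_min le_rfl (le_ciSup (hb i) s)
  · push Not at hall
    set S := {s | 1 ≤ ∑ i, Y i s}
    have hS0 : ∀ s ∈ S, 0 ≤ s := fun s hs => by
      by_contra h
      have h1 : 1 ≤ ∑ i, Y i s := hs
      rw [Finset.sum_eq_zero fun i _ => hY0 i s (not_le.1 h)] at h1
      norm_num at h1
    set T := sInf S
    have hlt : ∀ s < T, ∑ i, Y i s < 1 := fun s hs => by
      by_contra h
      exact absurd (csInf_le ⟨0, hS0⟩ (show s ∈ S from not_lt.1 h)) (not_le.2 hs)
    have hgt : ∀ s, T < s → 1 ≤ ∑ i, Y i s := fun s hs => by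
      obtain ⟨u, hu, hus⟩ := exists_lt_of_csInf_lt (show S.Nonempty from hall) hs
      exact le_trans hu (Finset.sum_le_sum fun i _ => hY i hus.le)
    set l : Fin n → ℝ := fun i => Function.leftLim (Y i) T
    set r : Fin n → ℝ := fun i => Function.rightLim (Y i) T
    have hlr : ∀ i, l i ≤ r i := fun i => (hY i).leftLim_le_rightLim le_rfl
    have hA : ∑ i, l i ≤ 1 :=
      le_of_tendsto (tendsto_finsetSum _ fun i _ => (hY i).tendsto_leftLim T)
        (eventually_nhdsWithin_of_forall fun s hs => (hlt s hs).le)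
    have hB : 1 ≤ ∑ i, r i :=
      ge_of_tendsto (tendsto_finsetSum _ fun i _ => (hY i).tendsto_rightLim T)
        (eventually_nhdsWithin_of_forall fun s hs => hgt s hs)
    have hl0 : ∀ i, 0 ≤ l i := fun i => (hnn i (T - 1)).trans ((hY i).le_leftLim (by linarith))
    obtain ⟨κ, hκ0, hκ1, hκ⟩ : ∃ κ : ℝ, 0 ≤ κ ∧ κ ≤ 1 ∧
        ∑ i, l i + κ * (∑ i, r i - ∑ i, l i) = 1 := by
      rcases eq_or_ne (∑ i, r i - ∑ i, l i) 0 with h | h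
      · exact ⟨0, le_rfl, zero_le_one, by linarith⟩
      · have hp : 0 < ∑ i, r i - ∑ i, l i := lt_of_le_of_ne (by linarith) h.symm
        refine ⟨(1 - ∑ i, l i) / (∑ i, r i - ∑ i, l i), div_nonneg (by linarith) hp.le,
          (div_le_one hp).2 (by linarith), ?_⟩
        rw [div_mul_cancel₀ _ h]; ring
    have hsum : ∑ i, (l i + κ * (r i - l i)) = 1 := by
      rw [Finset.sum_add_distrib, ← Finset.mul_sum, Finset.sum_sub_distrib, hκ]
    have hlL : ∀ i, l i ≤ l i + κ * (r i - l i) := fun i =>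
      le_add_of_nonneg_right (mul_nonneg hκ0 (sub_nonneg.2 (hlr i)))
    have hLr : ∀ i, l i + κ * (r i - l i) ≤ r i := fun i => by
      have := mul_le_mul_of_nonneg_right hκ1 (sub_nonneg.2 (hlr i))
      linarith
    refine ⟨fun i => l i + κ * (r i - l i), fun i => (hl0 i).trans (hlL i), hsum.le, ?_⟩
    -- The values at `T` itself lie anywhere between the one-sided limits, so the point `T` is
    -- discarded.
    filter_upwards [Measure.ae_ne volume T] with s hs
    rcases lt_or_gt_of_ne hs with h | h
    · refine (min_le_right _ _).trans (Finset.sum_le_sum fun i _ => ?_)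
      exact le_min le_rfl (((hY i).le_leftLim h).trans (hlL i))
    · refine (min_le_left _ _).trans (hsum.symm.le.trans (Finset.sum_le_sum fun i _ => ?_))
      exact le_min ((hLr i).trans ((hY i).rightLim_le h)) le_rfl

section Rates

variable {n : ℕ} {c : Fin n → ℝ≥0} {X : Fin n → ℝ → ℝ}

theorem IsCPFeasible.opening_nonneg (hX : IsCPFeasible c X) (i : Fin n) (s : ℝ) :
    0 ≤ X i s - X i (s - c i) :=
  sub_nonneg.2 (hX.monotone i (sub_le_self _ (c i).coe_nonneg))

theorem IsCPFeasible.intervalIntegrable_shift (hX : IsCPFeasible c X) (i : Fin n) (a b : ℝ) :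
    IntervalIntegrable (fun s => X i (s - c i)) volume a b :=
  ((hX.monotone i).comp fun _ _ h => sub_le_sub_right h _).intervalIntegrable

theorem IsCPFeasible.intervalIntegrable_opening (hX : IsCPFeasible c X) (i : Fin n) (a b : ℝ) :
    IntervalIntegrable (fun s => X i s - X i (s - c i)) volume a b :=
  (hX.monotone i).intervalIntegrable.sub (hX.intervalIntegrable_shift i a b)

theorem IsCPFeasible.xbar_nonneg (hX : IsCPFeasible c X) (i : Fin n) (t : ℝ) : 0 ≤ xbar c X i t := by
  rcases le_total 0 t with h | h
  · exact mul_nonneg (by positivity)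
      (intervalIntegral.integral_nonneg h fun s _ => hX.opening_nonneg i s)
  · rw [xbar, intervalIntegral.integral_symm, mul_neg, ← neg_mul]
    refine mul_nonneg ?_ (intervalIntegral.integral_nonneg h fun s _ => hX.opening_nonneg i s)
    rw [neg_nonneg]
    exact one_div_nonpos.2 h

theorem IsCPFeasible.xbar_le_one (hX : IsCPFeasible c X) (i : Fin n) (t : ℝ) : xbar c X i t ≤ 1 := by
  have h1 : ‖∫ s in (0 : ℝ)..t, (X i s - X i (s - c i))‖ ≤ 1 * |t - 0| := by
    refine intervalIntegral.norm_integral_le_of_norm_le_const fun s _ => ?_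
    rw [Real.norm_of_nonneg (hX.opening_nonneg i s)]
    linarith [hX.le_one i s, hX.nonneg i (s - c i)]
  rw [one_mul, sub_zero] at h1
  refine (le_abs_self _).trans ?_
  rw [xbar, abs_mul, abs_div, abs_one, one_div_mul_eq_div]
  exact div_le_one_of_le₀ h1 (abs_nonneg t)

theorem IsCPFeasible.isRate_arrivalRate (hX : IsCPFeasible c X) (i : Fin n) :
    IsRate (arrivalRate c X i) := by
  have hc : Continuous fun t => ∫ s in (0 : ℝ)..t, (X i s - X i (s - c i)) :=
    intervalIntegral.continuous_primitive (hX.intervalIntegrable_opening i) 0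
  have hc2 : Continuous fun t : ℝ => t / 2 := continuous_id.div_const 2
  refine ⟨?_, fun t => mul_nonneg (by positivity) (hX.xbar_nonneg i _), ⟨1 / c i, fun t => ?_⟩, ?_⟩
  · exact (((measurable_const.div measurable_id).mul hc.measurable).comp hc2.measurable).const_mul _
  · exact mul_le_of_le_one_right (by positivity) (hX.xbar_le_one i _)
  · refine (countable_singleton (0 : ℝ)).mono fun t ht => ?_
    by_contra h0
    refine ht (ContinuousAt.mul continuousAt_const ?_)
    have h2 : t / 2 ≠ 0 := div_ne_zero h0 two_ne_zero
    have : ContinuousAt (xbar c X i) (t / 2) :=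
      (continuousAt_const.div continuousAt_id h2).mul hc.continuousAt
    exact ContinuousAt.comp (f := fun t : ℝ => t / 2) this hc2.continuousAt

/-- The left-hand side is the average, over the first `t / 2` time units, of the expected number of
boxes being opened. -/
theorem IsCPFeasible.sum_mul_arrivalRate_le_one (hX : IsCPFeasible c X) (hc : ∀ i, 0 < c i) {t : ℝ}
    (ht : 0 < t) : ∑ i, c i * arrivalRate c X i t ≤ 1 := by
  have h1 : ∀ i, c i * arrivalRate c X i t =
      1 / (t / 2) * ∫ s in (0 : ℝ)..t / 2, (X i s - X i (s - c i)) := fun i => by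
    have : (c i : ℝ) ≠ 0 := by exact_mod_cast (hc i).ne'
    rw [arrivalRate, ← mul_assoc, mul_one_div_cancel this, one_mul, xbar]
  rw [Finset.sum_congr rfl fun i _ => h1 i, ← Finset.mul_sum,
    ← intervalIntegral.integral_finsetSum fun i _ => hX.intervalIntegrable_opening i _ _,
    one_div_mul_eq_div, div_le_one (by positivity)]
  calc _ ≤ ∫ s in (0 : ℝ)..t / 2, (1 : ℝ) := by
        refine intervalIntegral.integral_mono_on (by positivity)
          (by
            simpa only [Finset.sum_fn] using IntervalIntegrable.sum Finset.univ
              fun i _ => hX.intervalIntegrable_opening i 0 (t / 2))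
          intervalIntegrable_const fun s hs => hX.opening_le_one s hs.1
    _ = t / 2 := by simp

/-- The integral defining `xbar` telescopes to the integral of `X i` over the window of length `c i`
ending at `t / 2`, where `X i` is at least its value at the left end. The factor `c i` cancels
against the rate. -/
theorem IsCPFeasible.le_arrivalRate (hX : IsCPFeasible c X) (hc : ∀ i, 0 < c i) (i : Fin n) {t : ℝ}
    (ht : 0 < t) : 2 / t * X i (t / 2 - c i) ≤ arrivalRate c X i t := by
  have hci : (0 : ℝ) < c i := by exact_mod_cast hc i
  have hXi : ∀ a b, IntervalIntegrable (X i) volume a b := fun _ _ =>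
    (hX.monotone i).intervalIntegrable
  set u := t / 2 with hu
  have h1 : ∫ s in (0 : ℝ)..u, (X i s - X i (s - c i)) = ∫ s in (u - c i)..u, X i s := by
    rw [intervalIntegral.integral_sub (hXi _ _) (hX.intervalIntegrable_shift i _ _),
      intervalIntegral.integral_comp_sub_right (fun s => X i s),
      intervalIntegral.integral_interval_sub_interval_comm (hXi _ _) (hXi _ _) (hXi _ _)]
    have h0 : ∫ s in (0 : ℝ)..(0 - c i), X i s = 0 := by
      rw [intervalIntegral.integral_symm, neg_eq_zero,
        intervalIntegral.integral_of_le (by linarith), ← setIntegral_congr_set Ioo_ae_eq_Ioc]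
      exact setIntegral_eq_zero_of_forall_eq_zero fun s hs => hX.eq_zero_of_neg i s hs.2
    rw [h0, zero_sub, ← intervalIntegral.integral_symm]
  have h2 : c i * X i (u - c i) ≤ ∫ s in (u - c i)..u, X i s := by
    calc c i * X i (u - c i) = ∫ s in (u - c i)..u, X i (u - c i) := by simp
      _ ≤ _ := intervalIntegral.integral_mono_on (by linarith) intervalIntegrable_const (hXi _ _)
          fun s hs => hX.monotone i hs.1
  rw [arrivalRate, xbar, h1]
  calc 2 / t * X i (u - c i) = 1 / c i * (1 / u * (c i * X i (u - c i))) := by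
        rw [hu]; field_simp
    _ ≤ _ := by gcongr

end Rates

/-- In every scenario, the arrivals can be thinned so that stopping at the first of the remaining
arrivals is possible and costs at most four times the convex program. -/
theorem exists_thinned_rates {n : ℕ} (hn : 0 < n) {c : Fin n → ℝ≥0} (hc : ∀ i, 0 < c i)
    {X : Fin n → ℝ → ℝ} (hX : IsCPFeasible c X) (v : Fin n → ℝ≥0) :
    ∃ r : Fin n → ℝ → ℝ, (∀ i, IsRate (r i)) ∧ (∀ i t, r i t ≤ arrivalRate c X i t) ∧
      (∀ i, ∀ t < (c i + v i : ℝ), r i t = 0) ∧ (∀ t, 0 < t → ∑ i, r i t ≤ 2 / t) ∧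
      (∫⁻ t in Ioi (0 : ℝ), ENNReal.ofReal (surv (fun u => ∑ i, r i u) t)) +
        ∑ i, (v i : ℝ≥0∞) * ∫⁻ t in Ioi (0 : ℝ),
          ENNReal.ofReal (r i t * surv (fun u => ∑ i, r i u) t) ≤ 4 * cpCost c v X := by
  obtain ⟨δ, hδ, hδc⟩ : ∃ δ : ℝ, 0 < δ ∧ ∀ i, δ ≤ 2 * c i := by
    have : Nonempty (Fin n) := ⟨⟨0, hn⟩⟩
    obtain ⟨i, hi⟩ := Finite.exists_min c
    have := hc i
    refine ⟨2 * c i, by positivity, fun j => ?_⟩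
    have : (c i : ℝ) ≤ c j := by exact_mod_cast hi j
    linarith
  obtain ⟨L, hL0, hL1, hL⟩ := exists_caps (Y := fun i s => X i (s - v i - c i))
    (fun i a b hab => hX.monotone i (by linarith))
    (fun i t ht => hX.eq_zero_of_neg i _ (by
      have := (v i).coe_nonneg
      have := (c i).coe_nonneg
      linarith)) (fun i t => hX.le_one i _)
  -- The argument is chosen so that `z i (2 s - v i) = min (X i (s - v i - c i)) (L i)`: after the
  -- delay by `v i` and the time change `t = 2 s`, the integrand of `cpCost` appears. Moreover `z i`
  -- vanishes for `t < 2 c i + v i`, which exceeds the balanced time.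
  set z : Fin n → ℝ → ℝ := fun i t => min (X i ((t - v i) / 2 - c i)) (L i) with hz_def
  have hz : ∀ i, Monotone (z i) := fun i a b hab =>
    min_le_min (hX.monotone i (by linarith)) le_rfl
  have hz0 : ∀ i, ∀ t < δ + v i, z i t = 0 := fun i t ht => by
    have := hδc i
    simp only [hz_def]
    rw [hX.eq_zero_of_neg i _ (by linarith), min_eq_left (hL0 i)]
  have hzδ : ∀ i, ∀ t < δ, z i t = 0 := fun i t ht =>
    hz0 i t (by linarith [(v i).coe_nonneg])
  have hz1 : ∀ t, ∑ i, z i t ≤ 1 := fun t =>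
    (Finset.sum_le_sum fun i _ => min_le_right _ _).trans hL1
  have hsum : (fun u : ℝ => ∑ i, 2 / u * z i u) = fun u => 2 / u * ∑ i, z i u := by
    funext u
    rw [Finset.mul_sum]
  refine ⟨fun i t => 2 / t * z i t,
    fun i => isRate_two_div_mul (hz i) hδ (hzδ i) fun t => min_le_right _ _, fun i t => ?_,
    fun i t ht => ?_, fun t ht => ?_, ?_⟩
  · beta_reduce
    rcases lt_or_ge t δ with h | h
    · rw [hzδ i t h, mul_zero]
      exact (hX.isRate_arrivalRate i).nonneg t
    · have ht : 0 < t := hδ.trans_le h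
      refine le_trans ?_ (hX.le_arrivalRate hc i ht)
      refine mul_le_mul_of_nonneg_left ((min_le_left _ _).trans (hX.monotone i ?_)) (by positivity)
      linarith [(v i).coe_nonneg]
  · have h : z i t = 0 := by
      simp only [hz_def]
      have := hc i
      have h1 : (0 : ℝ) < c i := by exact_mod_cast this
      rw [hX.eq_zero_of_neg i _ (by linarith), min_eq_left (hL0 i)]
    beta_reduce
    rw [h, mul_zero]
  · rw [← Finset.mul_sum]
    exact mul_le_of_le_one_right (by positivity) (hz1 t)
  · rw [hsum]
    have h1 := lintegral_surv_add_volume_le (v := fun i => (v i : ℝ)) (fun i => (v i).coe_nonneg)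
      hz hδ hz0 hz1
    simp only [ENNReal.ofReal_coe_nnreal] at h1
    refine h1.trans ?_
    have hs := lintegral_Ioi_comp_mul_left (F := fun t => ENNReal.ofReal (1 - ∑ i, z i (t - v i)))
      (measurable_const.sub (Finset.measurable_sum _ fun i _ =>
        (hz i).measurable.comp (measurable_id.sub_const _))).ennreal_ofReal two_pos 0
    rw [mul_zero] at hs
    rw [hs, ← mul_assoc, cpCost]
    have e : (2 : ℝ≥0∞) * ENNReal.ofReal 2 = 4 := by
      rw [ENNReal.ofReal_ofNat]; norm_num
    rw [e]
    refine mul_le_mul_right (lintegral_mono_ae (ae_restrict_of_ae ?_)) 4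
    filter_upwards [hL] with s hs
    refine ENNReal.ofReal_le_ofReal ?_
    have h2 : ∀ i, z i (2 * s - v i) = min (X i (s - v i - c i)) (L i) := fun i => by
      simp only [hz_def]
      congr 2
      ring
    rw [Finset.sum_congr rfl fun i _ => h2 i]
    rcases min_le_iff.1 hs with h | h
    · exact (sub_nonpos.2 h).trans (le_max_right _ _)
    · exact (sub_le_sub_left h 1).trans (le_max_left _ _)

/-! ### Laws of random times with a hazard rate -/

/-- `μ` is the law of a random time in `[0, ∞]` with hazard rate `r`. -/
structure IsTimeLaw (μ : Measure ℝ≥0∞) (r : ℝ → ℝ) : Prop where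
  prob : IsProbabilityMeasure μ
  survival : ∀ t : ℝ≥0, μ (Ioi (t : ℝ≥0∞)) = ENNReal.ofReal (surv r t)

/-- Inverse transform sampling: the generalized inverse `φ` of the survival function is applied to a
uniform variable on `[0, 1)`. Survival need not tend to 0; the value `⊤` carries the remaining mass.
-/
theorem exists_isTimeLaw {r : ℝ → ℝ} (hr : IsRate r) : ∃ μ, IsTimeLaw μ r := by
  set φ : ℝ → ℝ≥0∞ := fun u => ⨅ t : ℝ≥0, ⨅ _ : surv r t ≤ u, (t : ℝ≥0∞)
  have h1 : ∀ t : ℝ≥0, φ ⁻¹' Ioi (t : ℝ≥0∞) = Iio (surv r t) := by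
    intro t
    ext u
    simp only [mem_preimage, mem_Ioi, mem_Iio]
    constructor
    · intro h
      by_contra hu
      have h3 : φ u ≤ t := iInf_le_of_le t (iInf_le _ (not_lt.1 hu))
      exact absurd h3 (not_le.2 h)
    · intro h
      have h2 : ∀ᶠ s in 𝓝[>] (t : ℝ), u < surv r s :=
        (hr.continuous_surv.continuousAt.eventually_const_lt h).filter_mono nhdsWithin_le_nhds
      obtain ⟨s, hs, hts⟩ := (h2.and self_mem_nhdsWithin).exists
      have hts' : (t : ℝ) < s := hts
      have hs0 : 0 ≤ s := t.coe_nonneg.trans hts'.le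
      lift s to ℝ≥0 using hs0
      refine lt_of_lt_of_le (ENNReal.coe_lt_coe.2 (NNReal.coe_lt_coe.1 hts')) ?_
      refine le_iInf₂ fun w hw => ENNReal.coe_le_coe.2 ?_
      by_contra hws
      exact absurd (hs.trans_le (hr.antitone_surv (NNReal.coe_le_coe.2 (not_le.1 hws).le)))
        (not_lt.2 hw)
  have hm : Measurable φ := by
    refine measurable_of_Ioi fun a => ?_
    induction a with
    | top => simp
    | coe t => rw [h1]; exact measurableSet_Iio
  have hprob : IsProbabilityMeasure (volume.restrict (Ico (0 : ℝ) 1)) := ⟨by simp⟩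
  refine ⟨(volume.restrict (Ico (0 : ℝ) 1)).map φ, Measure.isProbabilityMeasure_map hm.aemeasurable,
    fun t => ?_⟩
  rw [Measure.map_apply hm measurableSet_Ioi, h1, Measure.restrict_apply measurableSet_Iio,
    show Iio (surv r t) ∩ Ico 0 1 = Ico 0 (surv r t) from ?_, Real.volume_Ico, sub_zero]
  ext u
  have := hr.surv_le_one t.coe_nonneg
  simp only [mem_inter_iff, mem_Iio, mem_Ico]
  constructor
  · exact fun h => ⟨h.2.1, h.1⟩
  · exact fun h => ⟨h.2, h.1, h.2.trans_le this⟩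

namespace IsTimeLaw

variable {μ ν : Measure ℝ≥0∞} {r : ℝ → ℝ}

theorem unique (hμ : IsTimeLaw μ r) (hν : IsTimeLaw ν r) : μ = ν := by
  have := hμ.prob
  have := hν.prob
  refine Measure.ext_of_Iic μ ν fun a => ?_
  rw [← compl_Ioi, prob_compl_eq_one_sub measurableSet_Ioi, prob_compl_eq_one_sub measurableSet_Ioi]
  induction a with
  | top => simp
  | coe t => rw [hμ.survival, hν.survival]

/-- Continuity of the survival function excludes atoms at finite times. -/
theorem measure_Ici (hμ : IsTimeLaw μ r) (hr : IsRate r) (t : ℝ≥0) :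
    μ (Ici (t : ℝ≥0∞)) = ENNReal.ofReal (surv r t) := by
  have := hμ.prob
  rcases eq_or_ne t 0 with rfl | ht
  · simp
  refine le_antisymm ?_ ((hμ.survival t).symm.le.trans (measure_mono Ioi_subset_Ici_self))
  have h1 : Tendsto (fun s => ENNReal.ofReal (surv r s)) (𝓝[<] (t : ℝ))
      (𝓝 (ENNReal.ofReal (surv r t))) :=
    ((ENNReal.continuous_ofReal.comp hr.continuous_surv).tendsto _).mono_left nhdsWithin_le_nhds
  refine ge_of_tendsto h1 ?_
  have ht0 : (0 : ℝ) < t := by exact_mod_cast pos_iff_ne_zero.2 ht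
  filter_upwards [self_mem_nhdsWithin, Ioo_mem_nhdsLT ht0] with s hs hs'
  have hs0 : 0 ≤ s := hs'.1.le
  lift s to ℝ≥0 using hs0
  rw [← hμ.survival s]
  refine measure_mono fun x hx => ?_
  exact lt_of_lt_of_le (ENNReal.coe_lt_coe.2 (NNReal.coe_lt_coe.1 hs)) hx

theorem measure_Ici_ofReal (hμ : IsTimeLaw μ r) (hr : IsRate r) {t : ℝ} (ht : 0 ≤ t) :
    μ (Ici (ENNReal.ofReal t)) = ENNReal.ofReal (surv r t) := by
  lift t to ℝ≥0 using ht
  rw [ENNReal.ofReal_coe_nnreal, hμ.measure_Ici hr]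

/-- On finite times the law has density `r * surv r`; a possible atom at `⊤` is left out. -/
theorem setLIntegral_Iio_top (hμ : IsTimeLaw μ r) (hr : IsRate r) {F : ℝ≥0∞ → ℝ≥0∞}
    (hF : Measurable F) : ∫⁻ x in Iio ⊤, F x ∂μ =
      ∫⁻ t in Ioi (0 : ℝ), ENNReal.ofReal (r t * surv r t) * F (ENNReal.ofReal t) := by
  have := hμ.prob
  have hd : Measurable fun t => ENNReal.ofReal (r t * surv r t) :=
    (hr.measurable.mul hr.continuous_surv.measurable).ennreal_ofReal
  have hmap : (μ.restrict (Iio ⊤)).map ENNReal.toReal =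
      (volume.restrict (Ioi (0 : ℝ))).withDensity fun t => ENNReal.ofReal (r t * surv r t) := by
    refine Measure.ext_of_Iic _ _ fun a => ?_
    rw [Measure.map_apply ENNReal.measurable_toReal measurableSet_Iic,
      Measure.restrict_apply (ENNReal.measurable_toReal measurableSet_Iic),
      withDensity_apply _ measurableSet_Iic, Measure.restrict_restrict measurableSet_Iic]
    rcases lt_or_ge a 0 with ha | ha
    · have e1 : ENNReal.toReal ⁻¹' Iic a ∩ Iio ⊤ = ∅ := by
        ext x
        simp only [mem_inter_iff, mem_preimage, mem_Iic, mem_empty_iff_false, iff_false, not_and]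
        exact fun h => absurd (ha.trans_le ENNReal.toReal_nonneg) (not_lt.2 h)
      have e2 : Iic a ∩ Ioi 0 = ∅ := by
        ext x
        simp only [mem_inter_iff, mem_Ioi, mem_Iic, mem_empty_iff_false, iff_false, not_and]
        intro h; linarith
      simp [e1, e2]
    · lift a to ℝ≥0 using ha
      have e1 : ENNReal.toReal ⁻¹' Iic (a : ℝ) ∩ Iio ⊤ = (Ioi (a : ℝ≥0∞))ᶜ := by
        ext x
        induction x with
        | top => simp
        | coe x => simp
      have e2 : Iic (a : ℝ) ∩ Ioi 0 = Ioc 0 (a : ℝ) := by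
        ext x; simp [and_comm]
      rw [e1, e2, prob_compl_eq_one_sub measurableSet_Ioi, hμ.survival,
        lintegral_Ioc_ofReal a.coe_nonneg (hr.intervalIntegrable_mul_surv _ _)
          fun t _ => mul_nonneg (hr.nonneg t) (surv_pos r t).le, hr.integral_mul_surv, surv_zero,
        ENNReal.ofReal_sub _ (surv_pos r a).le, ENNReal.ofReal_one]
  have hFo : Measurable fun t : ℝ => F (ENNReal.ofReal t) := hF.comp ENNReal.measurable_ofReal
  calc ∫⁻ x in Iio ⊤, F x ∂μ = ∫⁻ x in Iio ⊤, F (ENNReal.ofReal x.toReal) ∂μ :=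
        setLIntegral_congr_fun measurableSet_Iio fun x hx => by
          rw [ENNReal.ofReal_toReal (ne_of_lt hx)]
    _ = ∫⁻ t, F (ENNReal.ofReal t) ∂((μ.restrict (Iio ⊤)).map ENNReal.toReal) :=
        (lintegral_map hFo ENNReal.measurable_toReal).symm
    _ = _ := by
        rw [hmap, lintegral_withDensity_eq_lintegral_mul _ hd hFo]
        rfl

end IsTimeLaw

/-! ### Independent times: first arrivals and superposition -/

section Product

variable {n : ℕ} {μ μ' μ'' : Fin n → Measure ℝ≥0∞} {r r' r'' : Fin n → ℝ → ℝ}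

/-- The probability that the arrival `j` precedes all the times `max (α i) (b i)`. -/
theorem measure_first_le (hμ : ∀ i, IsTimeLaw (μ i) (r i)) (hr : ∀ i, IsRate (r i))
    (b : Fin n → ℝ≥0∞) (j : Fin n) :
    Measure.pi μ {α | α j < ⊤ ∧ ∀ i, α j ≤ max (α i) (b i)} ≤
      ∫⁻ t in Ioi (0 : ℝ), ENNReal.ofReal (r j t) *
        ∏ i, μ i {x | ENNReal.ofReal t ≤ max x (b i)} := by
  have hp : ∀ i, IsProbabilityMeasure (μ i) := fun i => (hμ i).prob
  obtain _ | m := n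
  · exact j.elim0
  have hS : MeasurableSet {p : ℝ≥0∞ × (Fin m → ℝ≥0∞) |
      p.1 < ⊤ ∧ ∀ i, p.1 ≤ max (p.2 i) (b (j.succAbove i))} := by
    simp only [ofPred_and, ofPred_forall]
    exact (measurableSet_lt measurable_fst measurable_const).inter (MeasurableSet.iInter fun i =>
      measurableSet_le measurable_fst
        (((measurable_pi_apply i).comp measurable_snd).max measurable_const))
  have hF : ∀ i, Measurable fun x : ℝ≥0∞ => μ i {y | x ≤ max y (b i)} := fun i => by
    refine Antitone.measurable fun x x' h => measure_mono fun y hy => ?_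
    exact h.trans hy
  have hmp := measurePreserving_piFinSuccAbove μ j
  calc Measure.pi μ {α | α j < ⊤ ∧ ∀ i, α j ≤ max (α i) (b i)}
      ≤ Measure.pi μ (MeasurableEquiv.piFinSuccAbove (fun _ => ℝ≥0∞) j ⁻¹'
          {p : ℝ≥0∞ × (Fin m → ℝ≥0∞) |
            p.1 < ⊤ ∧ ∀ i, p.1 ≤ max (p.2 i) (b (j.succAbove i))}) :=
        measure_mono fun α hα => ⟨hα.1, fun i => hα.2 _⟩
    _ = ∫⁻ x, Measure.pi (fun i => μ (j.succAbove i)) {y | x < ⊤ ∧ ∀ i, x ≤ max (y i) (b (j.succAbove i))}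
          ∂(μ j) := by
        rw [hmp.measure_preimage hS.nullMeasurableSet, Measure.prod_apply hS]
        rfl
    _ = ∫⁻ x in Iio ⊤, ∏ i, μ (j.succAbove i) {y | x ≤ max y (b (j.succAbove i))} ∂(μ j) := by
        rw [← lintegral_indicator measurableSet_Iio]
        refine lintegral_congr fun x => ?_
        by_cases hx : x < ⊤
        · rw [indicator_of_mem (show x ∈ Iio ⊤ from hx), ← Measure.pi_pi]
          congr 1
          ext y
          simp [hx]
        · rw [indicator_of_notMem (show x ∉ Iio ⊤ from hx)]
          simp [hx]
    _ = ∫⁻ t in Ioi (0 : ℝ), ENNReal.ofReal (r j t * surv (r j) t) *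
          ∏ i, μ (j.succAbove i) {y | ENNReal.ofReal t ≤ max y (b (j.succAbove i))} :=
        (hμ j).setLIntegral_Iio_top (hr j) (Finset.measurable_prod _ fun i _ => hF _)
    -- The factor `surv (r j) t` is enlarged to the probability that `t ≤ max x (b j)`, so that the
    -- product runs over all boxes including `j`.
    _ ≤ _ := by
        refine setLIntegral_mono' measurableSet_Ioi fun t ht => ?_
        rw [Fin.prod_univ_succAbove _ j, ENNReal.ofReal_mul ((hr j).nonneg t), mul_assoc,
          ← (hμ j).measure_Ici_ofReal (hr j) (le_of_lt ht)]
        gcongr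
        exact fun x (hx : ENNReal.ofReal t ≤ x) => show _ ≤ max x (b j) from le_max_of_le_left hx

theorem measure_forall_le [∀ i, SigmaFinite (μ i)] (b : Fin n → ℝ≥0∞) (t : ℝ≥0∞) :
    Measure.pi μ {α | ∀ i, t ≤ max (α i) (b i)} = ∏ i, μ i {x | t ≤ max x (b i)} := by
  rw [← Measure.pi_pi]
  congr 1
  ext α
  simp

theorem isTimeLaw_min {μ μ' : Measure ℝ≥0∞} {r r' : ℝ → ℝ} (hμ : IsTimeLaw μ r)
    (hμ' : IsTimeLaw μ' r') (hr : IsRate r) (hr' : IsRate r') :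
    IsTimeLaw ((μ.prod μ').map fun p => min p.1 p.2) fun t => r t + r' t := by
  have := hμ.prob
  have := hμ'.prob
  have hm : Measurable fun p : ℝ≥0∞ × ℝ≥0∞ => min p.1 p.2 := measurable_fst.min measurable_snd
  refine ⟨Measure.isProbabilityMeasure_map hm.aemeasurable, fun t => ?_⟩
  rw [Measure.map_apply hm measurableSet_Ioi,
    show (fun p : ℝ≥0∞ × ℝ≥0∞ => min p.1 p.2) ⁻¹' Ioi (t : ℝ≥0∞) = Ioi ↑t ×ˢ Ioi ↑t by ext; simp,
    Measure.prod_prod, hμ.survival, hμ'.survival, ← ENNReal.ofReal_mul (surv_pos _ _).le]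
  congr 1
  have := surv_sub (hr.add hr') hr t
  simp only [add_sub_cancel_left] at this
  exact this

/-- Independent times are minima of independent times, whose hazard rates add up. -/
theorem lintegral_pi_eq_lintegral_min (hμ : ∀ i, IsTimeLaw (μ i) (r i))
    (hμ' : ∀ i, IsTimeLaw (μ' i) (r' i)) (hμ'' : ∀ i, IsTimeLaw (μ'' i) (r'' i))
    (hr' : ∀ i, IsRate (r' i)) (hr'' : ∀ i, IsRate (r'' i)) (h : ∀ i t, r i t = r' i t + r'' i t)
    {F : (Fin n → ℝ≥0∞) → ℝ≥0∞} (hF : Measurable F) :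
    ∫⁻ α, F α ∂(Measure.pi μ) =
      ∫⁻ p, F (fun i => min (p.1 i) (p.2 i)) ∂((Measure.pi μ').prod (Measure.pi μ'')) := by
  have hp : ∀ i, IsProbabilityMeasure (μ i) := fun i => (hμ i).prob
  have hp' : ∀ i, IsProbabilityMeasure (μ' i) := fun i => (hμ' i).prob
  have hp'' : ∀ i, IsProbabilityMeasure (μ'' i) := fun i => (hμ'' i).prob
  have hm : Measurable fun p : ℝ≥0∞ × ℝ≥0∞ => min p.1 p.2 := measurable_fst.min measurable_snd
  have e : ∀ i, μ i = ((μ' i).prod (μ'' i)).map fun p => min p.1 p.2 := fun i => by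
    refine (hμ i).unique ?_
    rw [show r i = fun t => r' i t + r'' i t from funext (h i)]
    exact isTimeLaw_min (hμ' i) (hμ'' i) (hr' i) (hr'' i)
  have hps : ∀ i, SigmaFinite (((μ' i).prod (μ'' i)).map fun p => min p.1 p.2) := fun i => by
    rw [← e]; infer_instance
  have hg : Measurable fun (w : Fin n → ℝ≥0∞ × ℝ≥0∞) i => min (w i).1 (w i).2 :=
    measurable_pi_iff.2 fun i => hm.comp (measurable_pi_apply i)
  have hmp := measurePreserving_arrowProdEquivProdArrow ℝ≥0∞ ℝ≥0∞ (Fin n) μ' μ''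
  rw [show μ = fun i => ((μ' i).prod (μ'' i)).map fun p => min p.1 p.2 from funext e,
    ← Measure.pi_map_pi fun i => hm.aemeasurable, lintegral_map hF hg, ← hmp.lintegral_comp]
  · rfl
  · exact hF.comp (measurable_pi_iff.2 fun i => ((measurable_pi_apply i).comp measurable_fst).min
      ((measurable_pi_apply i).comp measurable_snd))

end Product

/-! ### Splitting the cost of Balanced Stopping -/

section

variable {n : ℕ}

theorem measurable_takeTime (c v : Fin n → ℝ≥0) (i : Fin n) :
    Measurable fun α => takeTime c v α i :=
  (measurable_pi_apply i).max measurable_const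

theorem measurable_stoppingTime (c v : Fin n → ℝ≥0) : Measurable (stoppingTime c v) :=
  Measurable.iInf fun i => measurable_takeTime c v i

theorem measurable_balancedCost (c v : Fin n → ℝ≥0) : Measurable (balancedCost c v) := by
  unfold balancedCost
  refine Measurable.ite (measurableSet_eq_fun (measurable_stoppingTime c v) measurable_const)
    measurable_const (Measurable.add (Finset.measurable_sum _ fun j _ => ?_)
      (Measurable.iSup fun i => ?_))
  · exact Measurable.ite (measurableSet_le (measurable_pi_apply j) (measurable_stoppingTime c v))
      measurable_const measurable_const
  · classical
    simp_rw [iSup_eq_if]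
    exact Measurable.ite (measurableSet_eq_fun (measurable_takeTime c v i)
      (measurable_stoppingTime c v)) measurable_const measurable_const

/-- If the box arrivals are split in two groups `x` and `y`, where `x` has no early arrivals, then
the cost of Balanced Stopping is bounded in terms of the opened boxes, of the stopping times of the
two groups, and of the first box of the group `x`. -/
theorem balancedCost_min_le (c v : Fin n → ℝ≥0) {x y : Fin n → ℝ≥0∞}
    (hx : ∀ i, (c i : ℝ≥0∞) + v i ≤ x i) :
    balancedCost c v (fun i => min (x i) (y i)) ≤
      ∑ j, (c j : ℝ≥0∞) * {α : Fin n → ℝ≥0∞ | α j < ⊤ ∧ ∀ i, α j ≤ max (α i) (c i + v i)}.indicator 1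
        (fun i => min (x i) (y i)) +
      {p : (Fin n → ℝ≥0∞) × (Fin n → ℝ≥0∞) | stoppingTime c v p.2 ≤ ⨅ i, p.1 i}.indicator
        (fun p => stoppingTime c v p.2) (x, y) +
      ∑ i, (v i : ℝ≥0∞) * {α : Fin n → ℝ≥0∞ | α i < ⊤ ∧ ∀ j, α i ≤ max (α j) 0}.indicator 1 x := by
  set α : Fin n → ℝ≥0∞ := fun i => min (x i) (y i)
  set ρ := ⨅ i, x i
  set σ := stoppingTime c v y
  -- `max` distributes over `min`, and a time `x i` past the balanced time is its own take time.
  have htake : ∀ i, takeTime c v α i = min (x i) (takeTime c v y i) := fun i => by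
    simp only [takeTime, α]
    rw [max_min_distrib_right, max_eq_left (hx i)]
  have hτ : stoppingTime c v α = min ρ σ := by
    simp only [stoppingTime, htake, ρ, σ]
    exact iInf_inf_eq
  have hσ : σ ≤ ρ → {p : (Fin n → ℝ≥0∞) × (Fin n → ℝ≥0∞) | stoppingTime c v p.2 ≤ ⨅ i, p.1 i}.indicator
      (fun p => stoppingTime c v p.2) (x, y) = σ := fun h =>
    indicator_of_mem (show (x, y) ∈ {p : (Fin n → ℝ≥0∞) × (Fin n → ℝ≥0∞) |
      stoppingTime c v p.2 ≤ ⨅ i, p.1 i} from h) _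
  rw [balancedCost]
  split_ifs with htop
  · rw [hτ, min_eq_top] at htop
    rw [hσ (by rw [htop.1]; exact le_top), htop.2]
    simp
  have hlt : stoppingTime c v α < ⊤ := lt_top_iff_ne_top.2 htop
  rw [add_assoc]
  refine add_le_add (Finset.sum_le_sum fun j _ => ?_) (iSup₂_le fun i hi => ?_)
  · split_ifs with hj
    · rw [indicator_of_mem (show α ∈ {α : Fin n → ℝ≥0∞ | α j < ⊤ ∧ ∀ i, α j ≤ max (α i) (c i + v i)}
        from ⟨hj.trans_lt hlt, fun i => hj.trans (iInf_le _ i)⟩)]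
      simp
    · exact zero_le
  -- If `σ ≤ ρ`, the taken box has `v i ≤ takeTime = σ`. Otherwise the taken box attains `ρ` and is
  -- a first arrival of the group `x`.
  · rcases le_or_gt σ ρ with h | h
    · refine le_add_of_le_left ?_
      rw [hσ h, ← min_eq_right h, ← hτ, ← hi]
      exact le_max_of_le_right le_add_self
    · refine le_add_of_le_right ?_
      rw [hτ, min_eq_left h.le, htake] at hi
      have hi' : x i = ρ := by
        rcases min_choice (x i) (takeTime c v y i) with h1 | h1
        · rwa [h1] at hi
        · rw [h1] at hi
          exact absurd (iInf_le (takeTime c v y) i) (not_le.2 (hi ▸ h))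
      have hmem : x ∈ {α : Fin n → ℝ≥0∞ | α i < ⊤ ∧ ∀ j, α i ≤ max (α j) 0} :=
        ⟨hi' ▸ h.trans_le le_top, fun j => le_max_of_le_left (hi' ▸ iInf_le _ j)⟩
      refine le_trans ?_ (Finset.single_le_sum (f := fun i => (v i : ℝ≥0∞) *
        {α : Fin n → ℝ≥0∞ | α i < ⊤ ∧ ∀ j, α i ≤ max (α j) 0}.indicator 1 x)
        (fun _ _ => zero_le) (Finset.mem_univ i))
      rw [indicator_of_mem hmem]
      simp

theorem measurableSet_first (b : Fin n → ℝ≥0∞) (j : Fin n) :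
    MeasurableSet {α : Fin n → ℝ≥0∞ | α j < ⊤ ∧ ∀ i, α j ≤ max (α i) (b i)} := by
  simp only [ofPred_and, ofPred_forall]
  exact (measurableSet_lt (measurable_pi_apply j) measurable_const).inter
    (MeasurableSet.iInter fun i => measurableSet_le (measurable_pi_apply j)
      ((measurable_pi_apply i).max measurable_const))

/-- Stopping a process with hazard rate at most `2 / t` at the time `s`, at a cost `s`, does not
increase its expected duration. -/
theorem mul_add_lintegral_le {q : ℝ → ℝ} (hpos : ∀ t, 0 ≤ q t)
    (hmono : ∀ s t, 0 < s → s ≤ t → s ^ 2 * q s ≤ t ^ 2 * q t) (p : ℝ≥0∞ → ℝ≥0∞)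
    (hp : ∀ t : ℝ, 0 ≤ t → p (ENNReal.ofReal t) = ENNReal.ofReal (q t)) (hptop : ∀ t, p ⊤ ≤ p t)
    (s : ℝ≥0∞) :
    s * p s + ∫⁻ t in Ioi (0 : ℝ), ENNReal.ofReal (q t) * {t : ℝ | ENNReal.ofReal t ≤ s}.indicator 1 t ≤
      ∫⁻ t in Ioi (0 : ℝ), ENNReal.ofReal (q t) := by
  have hle : ∀ s : ℝ≥0∞, ∫⁻ t in Ioi (0 : ℝ), ENNReal.ofReal (q t) *
      {t : ℝ | ENNReal.ofReal t ≤ s}.indicator 1 t ≤ ∫⁻ t in Ioi (0 : ℝ), ENNReal.ofReal (q t) :=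
    fun s => lintegral_mono fun t => mul_le_of_le_one_right' (indicator_le_self' (fun _ _ => zero_le) t)
  induction s with
  | top =>
    rcases eq_or_ne (p ⊤) 0 with h0 | h0
    · rw [h0, mul_zero, zero_add]
      exact hle ⊤
    -- A positive probability of never arriving makes the expected duration infinite.
    · have h1 : ∫⁻ t in Ioi (0 : ℝ), ENNReal.ofReal (q t) = ⊤ := by
        rw [eq_top_iff]
        calc ⊤ = ∫⁻ t in Ioi (0 : ℝ), p ⊤ := by
              rw [setLIntegral_const, Real.volume_Ioi, ENNReal.mul_top h0]
          _ ≤ _ := setLIntegral_mono' measurableSet_Ioi fun t ht => by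
              rw [← hp t (le_of_lt ht)]
              exact hptop _
      rw [h1]
      exact le_top
  | coe s =>
    rcases eq_or_ne s 0 with rfl | hs
    · simpa using hle 0
    · have hs0 : (0 : ℝ) < s := by exact_mod_cast pos_iff_ne_zero.2 hs
      have h1 := hp s hs0.le
      rw [ENNReal.ofReal_coe_nnreal] at h1
      rw [h1, ← ENNReal.ofReal_coe_nnreal, ← ENNReal.ofReal_mul hs0.le, add_comm,
        ← Ioc_union_Ioi_eq_Ioi hs0.le, lintegral_union measurableSet_Ioi Ioc_disjoint_Ioi_same,
        lintegral_union measurableSet_Ioi Ioc_disjoint_Ioi_same]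
      have h2 : ∫⁻ t in Ioi (s : ℝ), ENNReal.ofReal (q t) *
          {t : ℝ | ENNReal.ofReal t ≤ ENNReal.ofReal s}.indicator 1 t = 0 := by
        refine setLIntegral_eq_zero measurableSet_Ioi fun t ht => ?_
        rw [indicator_of_notMem, mul_zero, Pi.zero_apply]
        exact fun h => absurd ((ENNReal.ofReal_le_ofReal_iff hs0.le).1 h) (not_le.2 ht)
      rw [h2, add_zero]
      refine add_le_add (lintegral_mono fun t => ?_) (mul_le_tail hpos hmono hs0)
      exact mul_le_of_le_one_right' (indicator_le_self' (fun _ _ => zero_le) t)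

end

theorem surv_eq_one {r : ℝ → ℝ} {b t : ℝ} (h : ∀ s < b, r s = 0) (ht : 0 ≤ t) (htb : t ≤ b) :
    surv r t = 1 := by
  rw [surv, intervalIntegral.integral_of_le ht, ← setIntegral_congr_set Ioo_ae_eq_Ioc,
    setIntegral_eq_zero_of_forall_eq_zero fun s hs => h s (hs.2.trans_le htb), neg_zero, Real.exp_zero]

/-- The expected cost of Balanced Stopping when the first arrivals are independent and have the hazard
rates of Poisson Rounding. -/
theorem lintegral_balancedCost_le {n : ℕ} (hn : 0 < n) {c : Fin n → ℝ≥0} (hc : ∀ i, 0 < c i)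
    {X : Fin n → ℝ → ℝ} (hX : IsCPFeasible c X) (v : Fin n → ℝ≥0) {μ : Fin n → Measure ℝ≥0∞}
    (hμ : ∀ i, IsTimeLaw (μ i) (arrivalRate c X i)) :
    ∫⁻ α, balancedCost c v α ∂(Measure.pi μ) ≤ 4 * cpCost c v X := by
  obtain ⟨r, hr, hrle, hr0, hr2, hbound⟩ := exists_thinned_rates hn hc hX v
  have hl : ∀ i, IsRate (arrivalRate c X i) := hX.isRate_arrivalRate
  have hs : ∀ i, IsRate fun t => arrivalRate c X i t - r i t := fun i => (hl i).sub (hr i) (hrle i)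
  choose μ' hμ' using fun i => exists_isTimeLaw (hr i)
  choose μ'' hμ'' using fun i => exists_isTimeLaw (hs i)
  have hp : ∀ i, IsProbabilityMeasure (μ i) := fun i => (hμ i).prob
  have hp' : ∀ i, IsProbabilityMeasure (μ' i) := fun i => (hμ' i).prob
  have hp'' : ∀ i, IsProbabilityMeasure (μ'' i) := fun i => (hμ'' i).prob
  set q := surv fun u => ∑ i, r i u
  have hqr : IsRate fun u => ∑ i, r i u := isRate_sum hr
  have hqm : Measurable fun t => ENNReal.ofReal (q t) := hqr.continuous_surv.measurable.ennreal_ofReal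
  have hpos : ∀ t, 0 ≤ q t := fun t => (surv_pos _ t).le
  have hmono : ∀ s t, 0 < s → s ≤ t → s ^ 2 * q s ≤ t ^ 2 * q t := fun s t hs hst =>
    sq_mul_surv_le hqr hr2 hs hst
  have hq : ∀ t, 0 ≤ t → ∏ i, μ' i (Ici (ENNReal.ofReal t)) = ENNReal.ofReal (q t) := fun t ht => by
    rw [show q t = _ from surv_sum hr t, ENNReal.ofReal_prod_of_nonneg fun i _ => (surv_pos _ t).le]
    exact Finset.prod_congr rfl fun i _ => (hμ' i).measure_Ici_ofReal (hr i) ht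
  have hmax0 : ∀ t : ℝ≥0∞, {x : ℝ≥0∞ | t ≤ max x 0} = Ici t := fun t => by ext; simp
  set A : Fin n → Set (Fin n → ℝ≥0∞) := fun j => {α | α j < ⊤ ∧ ∀ i, α j ≤ max (α i) (c i + v i)}
  have hA : ∀ j, MeasurableSet (A j) := measurableSet_first _
  set B : Fin n → Set (Fin n → ℝ≥0∞) := fun j => {α | α j < ⊤ ∧ ∀ i, α j ≤ max (α i) 0}
  have hB : ∀ j, MeasurableSet (B j) := measurableSet_first _
  set C : Set ((Fin n → ℝ≥0∞) × (Fin n → ℝ≥0∞)) := {p | stoppingTime c v p.2 ≤ ⨅ i, p.1 i}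
  have hσ : Measurable (stoppingTime c v) := measurable_stoppingTime c v
  have hC : MeasurableSet C := measurableSet_le (hσ.comp measurable_snd)
    (Measurable.iInf fun i => (measurable_pi_apply i).comp measurable_fst)
  -- The thinned rates vanish before the balanced times, so thinned arrivals almost surely come no
  -- earlier.
  have hfirst : ∀ᵐ p ∂((Measure.pi μ').prod (Measure.pi μ'')), ∀ i, (c i : ℝ≥0∞) + v i ≤ p.1 i := by
    refine Measure.quasiMeasurePreserving_fst.ae
      (p := fun x : Fin n → ℝ≥0∞ => ∀ i, (c i : ℝ≥0∞) + v i ≤ x i) ?_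
    refine ae_all_iff.2 fun i => ?_
    refine (measurePreserving_eval μ' i).quasiMeasurePreserving.ae
      (p := fun x : ℝ≥0∞ => (c i : ℝ≥0∞) + v i ≤ x) ?_
    refine (mem_ae_iff_prob_eq_one measurableSet_Ici).2 ?_
    have h1 := (hμ' i).measure_Ici (hr i) (c i + v i)
    rwa [surv_eq_one (b := c i + v i) (hr0 i) (by positivity) (by simp), ENNReal.ofReal_one,
      ENNReal.coe_add] at h1
  have hmf : ∀ (s : Fin n → Set (Fin n → ℝ≥0∞)), (∀ j, MeasurableSet (s j)) → ∀ w : Fin n → ℝ≥0,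
      Measurable fun α => ∑ j, (w j : ℝ≥0∞) * (s j).indicator (1 : (Fin n → ℝ≥0∞) → ℝ≥0∞) α :=
    fun s hs w => Finset.measurable_sum _ fun j _ => (measurable_one.indicator (hs j)).const_mul _
  have hlf : ∀ (s : Fin n → Set (Fin n → ℝ≥0∞)), (∀ j, MeasurableSet (s j)) → ∀ (w : Fin n → ℝ≥0)
      (κ : Measure (Fin n → ℝ≥0∞)), ∫⁻ α, ∑ j, (w j : ℝ≥0∞) * (s j).indicator 1 α ∂κ =
        ∑ j, w j * κ (s j) := fun s hs w κ => by
    rw [lintegral_finsetSum _ fun j _ => (measurable_one.indicator (hs j)).const_mul _]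
    refine Finset.sum_congr rfl fun j _ => ?_
    rw [lintegral_const_mul _ (measurable_one.indicator (hs j)), lintegral_indicator_one (hs j)]
  have hsplit : ∀ {F : (Fin n → ℝ≥0∞) → ℝ≥0∞}, Measurable F → ∫⁻ α, F α ∂(Measure.pi μ) =
      ∫⁻ p, F (fun i => min (p.1 i) (p.2 i)) ∂((Measure.pi μ').prod (Measure.pi μ'')) := fun hF =>
    lintegral_pi_eq_lintegral_min hμ hμ' hμ'' hr hs (fun i t => by ring) hF
  -- The opening cost is at most the expected stopping time: box `j` arrives before stopping at
  -- density at most `λ j t * P(τ* ≥ t)`, and `∑ c j * λ j ≤ 1`. The probability `P(τ* ≥ t)` then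
  -- factors as `q t * P(σ ≥ t)`.
  have hearly : ∑ j, c j * Measure.pi μ (A j) ≤ ∫⁻ y, (∫⁻ t in Ioi (0 : ℝ), ENNReal.ofReal (q t) *
      {t : ℝ | ENNReal.ofReal t ≤ stoppingTime c v y}.indicator 1 t) ∂(Measure.pi μ'') := by
    have hg : ∀ i, Measurable fun t : ℝ => μ i {x | ENNReal.ofReal t ≤ max x (c i + v i)} := fun i => by
      refine Antitone.measurable fun t t' h => measure_mono fun x hx => ?_
      exact (ENNReal.ofReal_le_ofReal h).trans hx
    have hm : Measurable fun p : ℝ × (Fin n → ℝ≥0∞) =>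
        {t : ℝ | ENNReal.ofReal t ≤ stoppingTime c v p.2}.indicator (1 : ℝ → ℝ≥0∞) p.1 :=
      measurable_one.indicator (measurableSet_le (ENNReal.measurable_ofReal.comp measurable_fst)
        (hσ.comp measurable_snd))
    calc ∑ j, c j * Measure.pi μ (A j)
        ≤ ∑ j, c j * ∫⁻ t in Ioi (0 : ℝ), ENNReal.ofReal (arrivalRate c X j t) *
            ∏ i, μ i {x | ENNReal.ofReal t ≤ max x (c i + v i)} := by
          gcongr with j _
          exact measure_first_le hμ hl _ j
      _ = ∫⁻ t in Ioi (0 : ℝ), (∑ j, c j * ENNReal.ofReal (arrivalRate c X j t)) *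
            ∏ i, μ i {x | ENNReal.ofReal t ≤ max x (c i + v i)} := by
          simp_rw [Finset.sum_mul]
          have hm : ∀ j, Measurable fun t : ℝ => (c j : ℝ≥0∞) * ENNReal.ofReal (arrivalRate c X j t) *
              ∏ i, μ i {x | ENNReal.ofReal t ≤ max x (c i + v i)} := fun j =>
            ((hl j).measurable.ennreal_ofReal.const_mul _).mul
              (Finset.measurable_prod _ fun i _ => hg i)
          rw [lintegral_finsetSum _ fun j _ => hm j]
          refine Finset.sum_congr rfl fun j _ => ?_
          rw [← lintegral_const_mul' _ _ ENNReal.coe_ne_top]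
          simp_rw [mul_assoc]
      _ ≤ ∫⁻ t in Ioi (0 : ℝ), ENNReal.ofReal (q t) * Measure.pi μ''
            {y | ENNReal.ofReal t ≤ stoppingTime c v y} := by
          refine setLIntegral_mono' measurableSet_Ioi fun t ht => ?_
          have ht0 : 0 ≤ t := le_of_lt ht
          have h1 : ∑ j, c j * ENNReal.ofReal (arrivalRate c X j t) ≤ 1 := by
            rw [← ENNReal.ofReal_one]
            refine le_trans (le_of_eq ?_) (ENNReal.ofReal_le_ofReal
              (hX.sum_mul_arrivalRate_le_one hc ht))
            rw [ENNReal.ofReal_sum_of_nonneg fun i _ =>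
              mul_nonneg (c i).coe_nonneg ((hl i).nonneg t)]
            refine Finset.sum_congr rfl fun j _ => ?_
            rw [ENNReal.ofReal_mul (c j).coe_nonneg, ENNReal.ofReal_coe_nnreal]
          refine (mul_le_of_le_one_left' h1).trans (le_of_eq ?_)
          have h2 : {y | ENNReal.ofReal t ≤ stoppingTime c v y} =
              {y : Fin n → ℝ≥0∞ | ∀ i, ENNReal.ofReal t ≤ max (y i) (c i + v i)} := by
            ext y
            simp only [stoppingTime, takeTime, mem_ofPred_eq, le_iInf_iff]
          rw [h2, measure_forall_le, ← hq t ht0, ← Finset.prod_mul_distrib]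
          refine Finset.prod_congr rfl fun i _ => ?_
          rw [(hμ' i).measure_Ici_ofReal (hr i) ht0]
          -- Up to the balanced time all factors are 1; after it, the survival functions of the two
          -- thinned parts multiply to that of the full process.
          rcases le_or_gt (ENNReal.ofReal t) (c i + v i) with h | h
          · have hu : {x : ℝ≥0∞ | ENNReal.ofReal t ≤ max x (c i + v i)} = univ :=
              eq_univ_of_forall fun x => le_max_of_le_right h
            have h' : t ≤ c i + v i := by
              rw [← ENNReal.coe_add] at h
              exact_mod_cast ENNReal.ofReal_le_coe.1 h
            rw [hu, measure_univ, measure_univ, surv_eq_one (hr0 i) ht0 h']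
            simp
          · have hu : {x : ℝ≥0∞ | ENNReal.ofReal t ≤ max x (c i + v i)} = Ici (ENNReal.ofReal t) := by
              ext x
              simp [not_le.2 h]
            rw [hu, (hμ i).measure_Ici_ofReal (hl i) ht0, (hμ'' i).measure_Ici_ofReal (hs i) ht0,
              ← ENNReal.ofReal_mul (surv_pos _ _).le, surv_sub (hl i) (hr i)]
      _ = ∫⁻ t in Ioi (0 : ℝ), ∫⁻ y, ENNReal.ofReal (q t) *
            {t : ℝ | ENNReal.ofReal t ≤ stoppingTime c v y}.indicator 1 t ∂(Measure.pi μ'') := by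
          refine lintegral_congr fun t => ?_
          rw [lintegral_const_mul' _ _ ENNReal.ofReal_ne_top,
            ← lintegral_indicator_one (measurableSet_le measurable_const hσ)]
          rfl
      _ = _ := lintegral_lintegral_swap ((hqm.comp measurable_fst).mul hm).aemeasurable
  have hrest : ∫⁻ p, C.indicator (fun p => stoppingTime c v p.2) p
      ∂((Measure.pi μ').prod (Measure.pi μ'')) =
      ∫⁻ y, stoppingTime c v y * Measure.pi μ' {x | stoppingTime c v y ≤ ⨅ i, x i} ∂(Measure.pi μ'') := by
    have hm : Measurable (C.indicator fun p => stoppingTime c v p.2) :=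
      (hσ.comp measurable_snd).indicator hC
    rw [lintegral_prod_symm _ hm.aemeasurable]
    refine lintegral_congr fun y => ?_
    have hm : MeasurableSet {x : Fin n → ℝ≥0∞ | stoppingTime c v y ≤ ⨅ i, x i} :=
      measurableSet_le measurable_const (Measurable.iInf fun i => measurable_pi_apply i)
    rw [← setLIntegral_const, ← lintegral_indicator hm]
    rfl
  have hvol : ∑ j, v j * Measure.pi μ' (B j) ≤
      ∑ j, (v j : ℝ≥0∞) * ∫⁻ t in Ioi (0 : ℝ), ENNReal.ofReal (r j t * q t) := by
    gcongr with j _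
    refine (measure_first_le hμ' hr _ j).trans (setLIntegral_mono' measurableSet_Ioi fun t ht => ?_)
    simp only [hmax0]
    rw [hq t (le_of_lt ht), ENNReal.ofReal_mul ((hr j).nonneg t)]
  -- For fixed `y`, with `σ` its stopping time: `σ * P(ρ ≥ σ) + E min(ρ, σ) ≤ E ρ`.
  have hwait : ∀ y, stoppingTime c v y * Measure.pi μ' {x | stoppingTime c v y ≤ ⨅ i, x i} +
      ∫⁻ t in Ioi (0 : ℝ), ENNReal.ofReal (q t) *
        {t : ℝ | ENNReal.ofReal t ≤ stoppingTime c v y}.indicator 1 t ≤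
      ∫⁻ t in Ioi (0 : ℝ), ENNReal.ofReal (q t) := fun y => by
    refine mul_add_lintegral_le hpos hmono (fun s => Measure.pi μ' {x | s ≤ ⨅ i, x i})
      (fun t ht => ?_) (fun t => measure_mono fun x (hx : ⊤ ≤ ⨅ i, x i) => show t ≤ ⨅ i, x i from le_top.trans hx) _
    rw [← hq t ht, ← Measure.pi_pi]
    congr 1
    ext x
    simp [Pi.le_def]
  calc ∫⁻ α, balancedCost c v α ∂(Measure.pi μ)
      = ∫⁻ p, balancedCost c v (fun i => min (p.1 i) (p.2 i))
          ∂((Measure.pi μ').prod (Measure.pi μ'')) := hsplit (measurable_balancedCost c v)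
    _ ≤ ∫⁻ p, (∑ j, (c j : ℝ≥0∞) * (A j).indicator 1 (fun i => min (p.1 i) (p.2 i)) +
          C.indicator (fun p => stoppingTime c v p.2) p +
          ∑ j, (v j : ℝ≥0∞) * (B j).indicator 1 p.1) ∂((Measure.pi μ').prod (Measure.pi μ'')) :=
        lintegral_mono_ae (hfirst.mono fun p h => balancedCost_min_le c v h)
    _ = ∑ j, c j * Measure.pi μ (A j) + ∫⁻ p, C.indicator (fun p => stoppingTime c v p.2) p
          ∂((Measure.pi μ').prod (Measure.pi μ'')) + ∑ j, v j * Measure.pi μ' (B j) := by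
        have hm : Measurable (C.indicator fun p => stoppingTime c v p.2) :=
          (hσ.comp measurable_snd).indicator hC
        have hm' : Measurable fun p : (Fin n → ℝ≥0∞) × (Fin n → ℝ≥0∞) =>
            ∑ j, (v j : ℝ≥0∞) * (B j).indicator 1 p.1 := (hmf B hB v).comp measurable_fst
        rw [lintegral_add_right _ hm', lintegral_add_right _ hm, ← hsplit (hmf A hA c),
          hlf A hA c]
        congr 1
        rw [lintegral_prod _ hm'.aemeasurable]
        simp only [lintegral_const, measure_univ, mul_one]
        exact hlf B hB v _
    _ ≤ (∫⁻ y, (∫⁻ t in Ioi (0 : ℝ), ENNReal.ofReal (q t) *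
          {t : ℝ | ENNReal.ofReal t ≤ stoppingTime c v y}.indicator 1 t) ∂(Measure.pi μ'')) +
          (∫⁻ y, stoppingTime c v y * Measure.pi μ' {x | stoppingTime c v y ≤ ⨅ i, x i}
            ∂(Measure.pi μ'')) +
          ∑ j, (v j : ℝ≥0∞) * ∫⁻ t in Ioi (0 : ℝ), ENNReal.ofReal (r j t * q t) := by
        rw [hrest]
        gcongr
    _ ≤ (∫⁻ t in Ioi (0 : ℝ), ENNReal.ofReal (q t)) +
          ∑ j, (v j : ℝ≥0∞) * ∫⁻ t in Ioi (0 : ℝ), ENNReal.ofReal (r j t * q t) := by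
        gcongr
        rw [add_comm]
        refine (le_lintegral_add _ _).trans ((lintegral_mono hwait).trans ?_)
        simp
    _ ≤ _ := hbound

/-! ### First arrivals of Poisson processes -/

/-- The first arrival, computed from the rational times. -/
noncomputable def rationalFirstArrival (f : ℝ≥0 → ℕ) : ℝ≥0∞ :=
  ⨅ q : ℚ, if 1 ≤ f (Real.toNNReal q) then (Real.toNNReal q : ℝ≥0∞) else ⊤

theorem measurable_rationalFirstArrival : Measurable rationalFirstArrival :=
  Measurable.iInf fun _ => Measurable.ite
    (measurableSet_le measurable_const (measurable_pi_apply _)) measurable_const measurable_const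

/-- For a monotone path, any real arrival time is approximated from above by rationals, so a
countable infimum suffices. This makes the first arrival measurable. -/
theorem rationalFirstArrival_eq {f : ℝ≥0 → ℕ} (hf : Monotone f) :
    rationalFirstArrival f = firstArrival f := by
  refine le_antisymm (le_iInf₂ fun t ht => le_of_forall_gt fun b hb => ?_) (le_iInf fun q => ?_)
  · obtain ⟨q, -, htq, hqb⟩ := ENNReal.lt_iff_exists_rat_btwn.1 hb
    refine lt_of_le_of_lt ?_ hqb
    refine (iInf_le _ q).trans ?_
    rw [if_pos (ht.trans (hf (ENNReal.coe_lt_coe.1 htq).le))]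
  · split_ifs with h
    · exact iInf₂_le (f := fun (t : ℝ≥0) (_ : 1 ≤ f t) => (t : ℝ≥0∞)) _ h
    · exact le_top

/-- Right-continuity into the discrete space `ℕ` keeps a path that vanishes at `t` equal to 0
slightly beyond `t`, hence the strict inequality. -/
theorem lt_firstArrival_iff {f : ℝ≥0 → ℕ} (hf : Monotone f)
    (hc : ∀ t, ContinuousWithinAt f (Ici t) t) (t : ℝ≥0) : (t : ℝ≥0∞) < firstArrival f ↔ f t = 0 := by
  constructor
  · intro h
    by_contra h0
    have h1 : firstArrival f ≤ t :=
      iInf₂_le (f := fun (t : ℝ≥0) (_ : 1 ≤ f t) => (t : ℝ≥0∞)) t (Nat.one_le_iff_ne_zero.2 h0)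
    exact absurd h1 (not_le.2 h)
  · intro h
    have h1 : ∀ᶠ s in 𝓝[>] t, f s = 0 := by
      have := (hc t).mono Ioi_subset_Ici_self
      rw [ContinuousWithinAt, h, nhds_discrete, tendsto_pure] at this
      exact this
    obtain ⟨s, hs, hts⟩ := (h1.and self_mem_nhdsWithin).exists
    refine lt_of_lt_of_le (ENNReal.coe_lt_coe.2 hts) (le_iInf₂ fun w hw => ENNReal.coe_le_coe.2 ?_)
    by_contra hws
    have := hf (not_le.1 hws).le
    omega

section Poisson

variable {Ω : Type*} [MeasurableSpace Ω] {P : Measure Ω}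

theorem IsPoissonProcess.measurable_path {N : ℝ≥0 → Ω → ℕ} {r : ℝ → ℝ} (hN : IsPoissonProcess N r P) :
    Measurable fun ω t => N t ω :=
  measurable_pi_iff.2 hN.measurable

theorem IsPoissonProcess.ae_rationalFirstArrival_eq {N : ℝ≥0 → Ω → ℕ} {r : ℝ → ℝ}
    (hN : IsPoissonProcess N r P) : ∀ᵐ ω ∂P, rationalFirstArrival (fun t => N t ω) =
      firstArrival fun t => N t ω :=
  hN.monotone.mono fun _ h => rationalFirstArrival_eq h

/-- No arrival by time `t` means that the increment over `[0, t]` is 0, which has Poisson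
probability `exp (-∫ r)`. -/
theorem IsPoissonProcess.isTimeLaw [IsProbabilityMeasure P] {N : ℝ≥0 → Ω → ℕ} {r : ℝ → ℝ}
    (hN : IsPoissonProcess N r P) (hr : IsRate r) :
    IsTimeLaw (P.map fun ω => rationalFirstArrival fun t => N t ω) r := by
  have hm : Measurable fun ω => rationalFirstArrival fun t => N t ω :=
    measurable_rationalFirstArrival.comp hN.measurable_path
  refine ⟨Measure.isProbabilityMeasure_map hm.aemeasurable, fun t => ?_⟩
  have hinc : Measurable fun ω => N t ω - N 0 ω := (hN.measurable t).sub (hN.measurable 0)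
  have h1 : P ((fun ω => rationalFirstArrival fun t => N t ω) ⁻¹' Ioi (t : ℝ≥0∞)) =
      P ((fun ω => N t ω - N 0 ω) ⁻¹' {0}) := by
    refine measure_congr ?_
    filter_upwards [hN.ae_rationalFirstArrival_eq, hN.monotone, hN.rightContinuous, hN.zero]
      with ω h1 h2 h3 h4
    refine propext ?_
    change (t : ℝ≥0∞) < rationalFirstArrival (fun t => N t ω) ↔ N t ω - N 0 ω = 0
    rw [h1, h4, lt_firstArrival_iff h2 h3, Nat.sub_zero]
  rw [Measure.map_apply hm measurableSet_Ioi, h1, ← Measure.map_apply hinc (measurableSet_singleton 0),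
    hN.law_increment 0 t zero_le, poissonMeasure_singleton]
  simp only [pow_zero, mul_one, Nat.factorial_zero, Nat.cast_one, div_one, NNReal.coe_zero, surv]
  rw [Real.coe_toNNReal _ (intervalIntegral.integral_nonneg t.coe_nonneg fun u _ => hr.nonneg u)]

theorem balancedExpectedCost_le [IsProbabilityMeasure P] {n : ℕ} (hn : 0 < n) {c : Fin n → ℝ≥0}
    (hc : ∀ i, 0 < c i) {X : Fin n → ℝ → ℝ} (hX : IsCPFeasible c X) {N : Fin n → ℝ≥0 → Ω → ℕ}
    (hN : ∀ i, IsPoissonProcess (N i) (arrivalRate c X i) P)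
    (hindep : iIndepFun (fun i ω => fun t => N i t ω) P) (v : Fin n → ℝ≥0) :
    balancedExpectedCost c v N P ≤ 4 * cpCost c v X := by
  have hind : iIndepFun (fun i ω => rationalFirstArrival fun t => N i t ω) P :=
    hindep.comp (fun _ => rationalFirstArrival) fun _ => measurable_rationalFirstArrival
  have hm : ∀ i, Measurable fun ω => rationalFirstArrival fun t => N i t ω := fun i =>
    measurable_rationalFirstArrival.comp (hN i).measurable_path
  have hlaw := (iIndepFun_iff_map_fun_eq_pi_map fun i => (hm i).aemeasurable).1 hind
  calc balancedExpectedCost c v N P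
      = ∫⁻ ω, balancedCost c v (fun i => rationalFirstArrival fun t => N i t ω) ∂P := by
        refine lintegral_congr_ae ?_
        filter_upwards [ae_all_iff.2 fun i => (hN i).ae_rationalFirstArrival_eq] with ω h
        simp only [h]
    _ = ∫⁻ α, balancedCost c v α
          ∂(Measure.pi fun i => P.map fun ω => rationalFirstArrival fun t => N i t ω) := by
        rw [← hlaw, lintegral_map (measurable_balancedCost c v) (measurable_pi_iff.2 hm)]
    _ ≤ _ := lintegral_balancedCost_le hn hc hX v fun i => (hN i).isTimeLaw (hX.isRate_arrivalRate i)

end Poisson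

/-! ### Partially adaptive algorithms and the convex program -/

section Opt

variable {n : ℕ}

/-- The total cost of the first `k` boxes in the order of the algorithm. -/
def PartiallyAdaptive.openingTime (A : PartiallyAdaptive n) (c : Fin n → ℝ≥0) (k : ℕ) : ℝ≥0 :=
  ∑ j : Fin n, if (j : ℕ) < k then c (A.order j) else 0

theorem PartiallyAdaptive.openingTime_succ (A : PartiallyAdaptive n) (c : Fin n → ℝ≥0) (j : Fin n) :
    A.openingTime c (j + 1) = A.openingTime c j + c (A.order j) := by
  have : c (A.order j) = ∑ i : Fin n, if i = j then c (A.order i) else 0 := by simp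
  rw [PartiallyAdaptive.openingTime, PartiallyAdaptive.openingTime, this, ← Finset.sum_add_distrib]
  refine Finset.sum_congr rfl fun i _ => ?_
  rcases lt_trichotomy i j with h | h | h
  · have h' : (i : ℕ) < j := h
    simp [h', h.ne, Nat.lt_succ_of_lt h']
  · simp [h]
  · have h' : (j : ℕ) < i := h
    have h1 : ¬(i : ℕ) < j + 1 := by omega
    simp [h1, h.ne', h.not_gt]

theorem PartiallyAdaptive.openingTime_mono (A : PartiallyAdaptive n) (c : Fin n → ℝ≥0) :
    Monotone (A.openingTime c) := by
  intro k l hkl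
  refine Finset.sum_le_sum fun j _ => ?_
  split_ifs with h1 h2
  · exact le_rfl
  · omega
  · exact zero_le
  · exact le_rfl

/-- The start times of the boxes in the order of the algorithm, as a solution of the convex program. -/
noncomputable def PartiallyAdaptive.cpSolution (A : PartiallyAdaptive n) (c : Fin n → ℝ≥0)
    (i : Fin n) (t : ℝ) : ℝ :=
  if (A.openingTime c (A.order.symm i) : ℝ) ≤ t then 1 else 0

/-- A box ceases to be opened exactly when its successor in the order starts, so the sum of the
opening indicators telescopes to at most 1. -/
theorem PartiallyAdaptive.isCPFeasible_cpSolution (A : PartiallyAdaptive n) (c : Fin n → ℝ≥0) :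
    IsCPFeasible c (A.cpSolution c) where
  eq_zero_of_neg i t ht := if_neg (not_le.2 (ht.trans_le (NNReal.coe_nonneg _)))
  monotone i s t hst := by
    simp only [cpSolution]
    split_ifs with h1 h2
    · exact le_rfl
    · exact absurd (h1.trans hst) h2
    · exact zero_le_one
    · exact le_rfl
  nonneg i t := by
    simp only [cpSolution]
    split_ifs <;> norm_num
  le_one i t := by
    simp only [cpSolution]
    split_ifs <;> norm_num
  opening_le_one t _ := by
    set g : ℕ → ℝ := fun k => if (A.openingTime c k : ℝ) ≤ t then 1 else 0
    have hg : ∀ j : Fin n, A.cpSolution c (A.order j) t -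
        A.cpSolution c (A.order j) (t - c (A.order j)) = g j - g (j + 1) := fun j => by
      simp only [cpSolution, Equiv.symm_apply_apply, g, A.openingTime_succ, NNReal.coe_add,
        le_sub_iff_add_le]
    rw [← Equiv.sum_comp A.order, Finset.sum_congr rfl fun j _ => hg j,
      Fin.sum_univ_eq_sum_range fun k => g k - g (k + 1), Finset.sum_range_sub']
    have h1 : g 0 ≤ 1 := by simp only [g]; split_ifs <;> norm_num
    have h2 : 0 ≤ g n := by simp only [g]; split_ifs <;> norm_num
    linarith

/-- The integrand is at most 1, and it vanishes once box `i` has certainly finished and its volume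
has elapsed. -/
theorem cpCost_le_of_eq_one {c v : Fin n → ℝ≥0} {X : Fin n → ℝ → ℝ} (hX : IsCPFeasible c X) (i : Fin n)
    (s : ℝ≥0) (h : ∀ t : ℝ, s ≤ t → X i t = 1) : cpCost c v X ≤ s + c i + v i := by
  have h1 : ∀ t ∈ Ioi (0 : ℝ), ENNReal.ofReal (max (1 - ∑ i, X i (t - v i - c i)) 0) ≤
      (Iio ((s : ℝ) + c i + v i)).indicator 1 t := fun t _ => by
    have hnn : ∀ j, 0 ≤ X j (t - v j - c j) := fun j => hX.nonneg _ _
    by_cases ht : t < (s : ℝ) + c i + v i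
    · rw [indicator_of_mem (show t ∈ Iio _ from ht), Pi.one_apply, ← ENNReal.ofReal_one]
      refine ENNReal.ofReal_le_ofReal (max_le ?_ zero_le_one)
      exact sub_le_self _ (Finset.sum_nonneg fun j _ => hnn j)
    · rw [indicator_of_notMem (show t ∉ Iio _ from ht), nonpos_iff_eq_zero, ENNReal.ofReal_eq_zero]
      refine max_le (sub_nonpos.2 ?_) le_rfl
      rw [← h (t - v i - c i) (by linarith [not_lt.1 ht])]
      exact Finset.single_le_sum (f := fun j => X j (t - v j - c j)) (fun j _ => hnn j)
        (Finset.mem_univ i)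
  refine (setLIntegral_mono' measurableSet_Ioi h1).trans (le_of_eq ?_)
  rw [lintegral_indicator_one measurableSet_Iio, Measure.restrict_apply measurableSet_Iio, inter_comm,
    Ioi_inter_Iio, Real.volume_Ioo, sub_zero, ← NNReal.coe_add, ← NNReal.coe_add,
    ENNReal.ofReal_coe_nnreal, ENNReal.coe_add, ENNReal.coe_add]

/-- Each opened box finishes no later than the total opening cost paid, so `cpCost` is at most that
cost plus its volume. Knowing when to stop is not needed: the order alone determines the convex
solution, which is good in every scenario. -/
theorem PartiallyAdaptive.cpCost_le_cost (A : PartiallyAdaptive n) (c v : Fin n → ℝ≥0) :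
    cpCost c v (A.cpSolution c) ≤ A.cost c v := by
  rw [PartiallyAdaptive.cost, ← tsub_le_iff_left]
  refine le_iInf₂ fun j hj => tsub_le_iff_left.2 ?_
  have h1 : cpCost c v (A.cpSolution c) ≤ _ :=
    cpCost_le_of_eq_one (v := v) (A.isCPFeasible_cpSolution c) (A.order j) (A.openingTime c j)
      fun t ht => by
        rw [cpSolution, Equiv.symm_apply_apply, if_pos ht]
  refine h1.trans ?_
  gcongr
  rw [← ENNReal.coe_add, ← A.openingTime_succ]
  refine (ENNReal.coe_le_coe.2 (A.openingTime_mono c (Nat.succ_le_of_lt hj))).trans (le_of_eq ?_)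
  rw [PartiallyAdaptive.openingTime, ENNReal.ofNNReal_finsetSum]
  exact Finset.sum_congr rfl fun i _ => by split_ifs <;> simp

theorem cpOpt_le_opt (c : Fin n → ℝ≥0) (D : Measure (Fin n → ℝ≥0)) : cpOpt c D ≤ opt c D :=
  le_iInf fun A => (iInf₂_le _ (A.isCPFeasible_cpSolution c)).trans
    (lintegral_mono fun v => A.cpCost_le_cost c v)

/-- Balanced Stopping, for fixed arrival times, is a partially adaptive algorithm. -/
theorem exists_partiallyAdaptive_cost_le (hn : 0 < n) (c : Fin n → ℝ≥0) (α : Fin n → ℝ≥0∞) :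
    ∃ A : PartiallyAdaptive n, Monotone (fun j => α (A.order j)) ∧
      ∀ v : Fin n → ℝ≥0, A.cost c v ≤ balancedCost c v α := by
  set o := Tuple.sort α
  have ho : Monotone fun j => α (o j) := Tuple.monotone_sort α
  refine ⟨{ order := o
            -- Stop when some opened box can be taken strictly before the next arrival. Strictness
            -- matters: a box arriving exactly at `τ*` is also opened by Balanced Stopping.
            stopSet := fun k => {v | ∃ h : k < n,
              (⨅ j : Fin n, ⨅ _ : (j : ℕ) < k, takeTime c v α (o j)) < α (o ⟨k, h⟩)}
            measurableSet_stopSet := fun k => ?_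
            adapted := fun k v w h => ?_ }, ho, fun v => ?_⟩
  · by_cases hk : k < n
    · simp only [hk, exists_true_left]
      refine measurableSet_lt (Measurable.iInf fun j => Measurable.iInf fun _ => ?_) measurable_const
      have hm : Measurable fun v : Fin n → ℝ≥0 => (c (o j) : ℝ≥0∞) + v (o j) :=
        measurable_const.add (measurable_pi_apply (o j)).coe_nnreal_ennreal
      exact measurable_const.max hm
    · simp [hk]
  · have : (⨅ j : Fin n, ⨅ _ : (j : ℕ) < k, takeTime c v α (o j)) =
        ⨅ j : Fin n, ⨅ _ : (j : ℕ) < k, takeTime c w α (o j) :=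
      iInf_congr fun j => iInf_congr fun hj => by rw [takeTime, takeTime, h j hj]
    simp only [mem_ofPred_eq, this]
  · set A : PartiallyAdaptive n := _
    change A.cost c v ≤ _
    rw [balancedCost]
    split_ifs with htop
    · exact le_top
    set τ := stoppingTime c v α
    have : Nonempty (Fin n) := ⟨⟨0, hn⟩⟩
    obtain ⟨i, hi⟩ := exists_eq_ciInf_of_finite (f := takeTime c v α)
    have hiτ : takeTime c v α i = τ := hi
    obtain ⟨p, rfl⟩ := o.surjective i
    have hpα : α (o p) ≤ τ := hiτ ▸ le_max_left _ _
    have hmem : 1 ≤ A.numOpened v ∧ (n ≤ A.numOpened v ∨ v ∈ A.stopSet (A.numOpened v)) :=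
      Nat.sInf_mem (s := {k : ℕ | 1 ≤ k ∧ (n ≤ k ∨ v ∈ A.stopSet k)}) ⟨n, hn, Or.inl le_rfl⟩
    -- A box arriving after `τ` comes later in the order than the minimizer `p`, and `A` would have
    -- stopped before opening it.
    have hearly : ∀ j : Fin n, (j : ℕ) < A.numOpened v → α (o j) ≤ τ := fun j hj => by
      by_contra hτ
      have hτ' := not_le.1 hτ
      have hpj : p < j := by
        by_contra h
        exact hτ ((ho (not_lt.1 h)).trans hpα)
      have hle : A.numOpened v ≤ j := by
        refine Nat.sInf_le ⟨Nat.one_le_of_lt (show (p : ℕ) < j from hpj), Or.inr ⟨j.2, ?_⟩⟩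
        refine lt_of_le_of_lt ?_ hτ'
        rw [← hiτ]
        exact iInf₂_le (f := fun (j' : Fin n) (_ : (j' : ℕ) < j) => takeTime c v α (o j')) p hpj
      omega
    -- Stopping before `p` would need a take time below the next arrival, which is at most `α (o p)
    -- ≤ τ`, contradicting the minimality of `τ`.
    have hp : (p : ℕ) < A.numOpened v := by
      rcases hmem.2 with h | ⟨h, hlt⟩
      · exact p.2.trans_le h
      · by_contra hk
        have h1 : α (o ⟨A.numOpened v, h⟩) ≤ α (o p) := ho (not_lt.1 hk)
        have h2 : τ ≤ ⨅ j : Fin n, ⨅ _ : (j : ℕ) < A.numOpened v, takeTime c v α (o j) :=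
          le_iInf₂ fun j _ => iInf_le _ _
        exact absurd (h2.trans_lt hlt) (not_lt.2 (h1.trans hpα))
    rw [PartiallyAdaptive.cost]
    refine add_le_add ?_ ?_
    · refine le_trans ?_ (Equiv.sum_comp o _).le
      refine Finset.sum_le_sum fun j _ => ?_
      split_ifs with h1 h2 h2
      · exact le_rfl
      · exact absurd (hearly j h1) h2
      · exact zero_le
      · exact le_rfl
    · refine (iInf₂_le (f := fun (j : Fin n) (_ : (j : ℕ) < A.numOpened v) =>
        (v (o j) : ℝ≥0∞)) p hp).trans ?_
      exact le_iSup₂ (f := fun (i : Fin n) (_ : takeTime c v α i = τ) => (v i : ℝ≥0∞)) (o p) hiτ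

end Opt

/-! ### The linear program of a scenario -/

/-- Layer cake writes the LP objective as `∫ (1 - ∑ Z i (s - v i - c i))` over `s > 0`, up to left
limits, since the total masses sum to 1. As `Z i ≤ X i` and the integrand is nonnegative, it
dominates the integrand of `cpCost`. -/
theorem cpCost_le_lpCost {n : ℕ} {c : Fin n → ℝ≥0} {X : Fin n → ℝ → ℝ} (hX : IsCPFeasible c X)
    (v : Fin n → ℝ≥0) {Z : Fin n → ℝ → ℝ} (hZ : IsLPAssignment X Z) :
    cpCost c v X ≤ lpCost c v Z hZ.monotone := by
  have hZX : ∀ i t, Z i t ≤ X i t := fun i t => by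
    -- Comparing increments from a negative time, where both functions vanish, also covers a jump at
    -- 0.
    have h := hZ.sub_le_sub i (min t (-1)) t (min_le_left _ _)
    have h0 : min t (-1) < 0 := (min_le_right _ _).trans_lt (by norm_num)
    rw [hZ.eq_zero_of_neg i _ h0, hX.eq_zero_of_neg i _ h0] at h
    linarith
  set l : Fin n → ℝ := fun i => ⨆ t, Z i t
  have hl : ∀ i, Tendsto (Z i) atTop (𝓝 (l i)) := fun i =>
    tendsto_atTop_ciSup (hZ.monotone i) ⟨1, by rintro _ ⟨t, rfl⟩; exact hZ.le_one i t⟩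
  have hsum : ∑ i, l i = 1 := tendsto_nhds_unique (tendsto_finsetSum _ fun i _ => hl i) hZ.total
  have hZl : ∀ i t, Z i t ≤ l i := fun i t => (hZ.monotone i).ge_of_tendsto (hl i) t
  set F : Fin n → StieltjesFunction ℝ := fun i => (hZ.monotone i).stieltjesFunction
  have hF : ∀ i t, F i t = Function.rightLim (Z i) t := fun i t => (hZ.monotone i).stieltjesFunction_eq t
  have hFl : ∀ i, Tendsto (F i) atTop (𝓝 (l i)) := fun i => by
    refine tendsto_of_tendsto_of_tendsto_of_le_of_le (hl i)
      ((hl i).comp (tendsto_atTop_add_const_right atTop 1 tendsto_id)) (fun t => ?_) fun t => ?_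
    · rw [hF]; exact (hZ.monotone i).le_rightLim le_rfl
    · rw [hF]; exact (hZ.monotone i).rightLim_le (lt_add_one t)
  have hleft : ∀ i t, Function.leftLim (F i) t ≤ Z i t := fun i t =>
    le_of_tendsto ((F i).mono.tendsto_leftLim t) (eventually_nhdsWithin_of_forall fun s hs => by
      rw [hF]; exact (hZ.monotone i).rightLim_le hs)
  have hm : ∀ i, Measurable fun s => (F i).measure (Ici (s - v i - c i)) := fun i => by
    refine Antitone.measurable fun s s' h => measure_mono (Ici_subset_Ici.2 (by linarith))
  have hlayer : ∀ i, ∫⁻ t, ENNReal.ofReal (t + c i + v i) ∂(F i).measure =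
      ∫⁻ s in Ioi (0 : ℝ), (F i).measure (Ici (s - v i - c i)) := fun i => by
    have hmeas : Measurable fun t : ℝ => max (t + c i + v i) 0 :=
      ((measurable_id.add_const _).add_const _).max measurable_const
    have h1 : ∀ t : ℝ, ENNReal.ofReal (t + c i + v i) = ENNReal.ofReal (max (t + c i + v i) 0) :=
      fun t => by simp [ENNReal.ofReal_max]
    simp_rw [h1]
    refine (lintegral_eq_lintegral_meas_le (f := fun t => max (t + c i + v i) 0) _
      (ae_of_all _ fun t => le_max_right _ _) hmeas.aemeasurable).trans ?_
    refine setLIntegral_congr_fun measurableSet_Ioi fun s hs => ?_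
    have hs' : (0 : ℝ) < s := hs
    congr 1
    ext t
    simp only [mem_ofPred_eq, mem_Ici, le_max_iff, not_le.2 hs', or_false]
    constructor <;> intro h <;> linarith
  rw [lpCost, Finset.sum_congr rfl fun i _ => hlayer i, ← lintegral_finsetSum _ fun i _ => hm i]
  refine lintegral_mono fun s => ?_
  have h1 : ∀ i, (F i).measure (Ici (s - v i - c i)) =
      ENNReal.ofReal (l i - Function.leftLim (F i) (s - v i - c i)) := fun i =>
    (F i).measure_Ici (hFl i) _
  simp only [h1]
  rw [← ENNReal.ofReal_sum_of_nonneg fun i _ => sub_nonneg.2 ((hleft i _).trans (hZl i _)),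
    Finset.sum_sub_distrib, hsum]
  refine ENNReal.ofReal_le_ofReal (max_le ?_ ?_)
  · exact sub_le_sub_left (Finset.sum_le_sum fun i _ => (hleft i _).trans (hZX i _)) 1
  · rw [← hsum, sub_nonneg]
    exact Finset.sum_le_sum fun i _ => (hleft i _).trans (hZl i _)

end Pandora

theorem theorem4 (n : ℕ) (hn : 0 < n)
    (c : Fin n → ℝ≥0) (hc : ∀ i, 0 < c i)
    (D : Measure (Fin n → ℝ≥0)) [IsProbabilityMeasure D]
    (X : Fin n → ℝ → ℝ) (hX : Pandora.IsCPFeasible c X)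
    {Ω : Type*} [MeasurableSpace Ω] (P : Measure Ω) [IsProbabilityMeasure P]
    (N : Fin n → ℝ≥0 → Ω → ℕ)
    (hN : ∀ i, Pandora.IsPoissonProcess (N i) (Pandora.arrivalRate c X i) P)
    (hindep : iIndepFun (fun i ω => fun t => N i t ω) P) :
    -- approximation of the optimal partially adaptive algorithm, for `X` (approximately) optimal
    (∀ ε : ℝ≥0, Pandora.cpObjective c D X ≤ (1 + ε) * Pandora.cpOpt c D →
      ∫⁻ v, Pandora.balancedExpectedCost c v N P ∂D ≤ 4 * (1 + ε) * Pandora.opt c D) ∧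
    -- in every fixed scenario, for every feasible `X`: against the convex program
    (∀ v : Fin n → ℝ≥0,
      Pandora.balancedExpectedCost c v N P ≤ 4 * Pandora.cpCost c v X) ∧
    -- in every fixed scenario, for every feasible `X`: against the linear program
    (∀ (v : Fin n → ℝ≥0) (Z : Fin n → ℝ → ℝ) (hZ : Pandora.IsLPAssignment X Z),
      Pandora.balancedExpectedCost c v N P ≤ 4 * Pandora.lpCost c v Z hZ.monotone) ∧
    -- for every realization of the arrivals, the algorithm is itself a partially adaptive algorithm
    -- which opens the boxes in the order of their arrivals
    (∀ α : Fin n → ℝ≥0∞, ∃ A : Pandora.PartiallyAdaptive n,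
      Monotone (fun j => α (A.order j)) ∧
      ∀ v : Fin n → ℝ≥0, A.cost c v ≤ Pandora.balancedCost c v α) := by
  have hbal := Pandora.balancedExpectedCost_le hn hc hX hN hindep
  refine ⟨fun ε hε => ?_, hbal,
    fun v Z hZ => (hbal v).trans (mul_le_mul_right (Pandora.cpCost_le_lpCost hX v hZ) 4),
    Pandora.exists_partiallyAdaptive_cost_le hn c⟩
  calc ∫⁻ v, Pandora.balancedExpectedCost c v N P ∂D
      ≤ ∫⁻ v, 4 * Pandora.cpCost c v X ∂D := lintegral_mono hbal
    _ = 4 * Pandora.cpObjective c D X := lintegral_const_mul' _ _ ENNReal.ofNat_ne_top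
    _ ≤ 4 * ((1 + ε) * Pandora.opt c D) :=
        mul_le_mul_right (hε.trans (mul_le_mul_right (Pandora.cpOpt_le_opt c D) _)) 4
    _ = 4 * (1 + ε) * Pandora.opt c D := (mul_assoc _ _ _).symm
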